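/- Let $\Lambda=(\Lambda_i)_{i\le m}$ be a family of subsets of $\mathbb R^d$ such that each $\Lambda_i$ and $\bigcup_i\Lambda_i$ are Delone sets. Suppose that $Q:\mathbb R^d\to\mathbb R^d$ is a linear map that is expansive (there are $c>1$ and a metric $e$ inducing the standard topology with $e(Qx,Qy)\ge c\,e(x,y)$ for all $x,y$), and that $\mathcal D_{ij}\subset\mathbb R^d$ ($i,j\le m$) are finite sets such that, for every $i$, $\Lambda_i=\bigcup_{j}(Q\Lambda_j+\mathcal D_{ij})$, where the sets $Q\Lambda_j+a$ ($j\le m$, $a\in\mathcal D_{ij}$) are pairwise disjoint. Suppose that the matrix $(\#\mathcal D_{ij})_{i,j}$ is primitive. For $X=(X_i)_{i\le m}$ put $\Phi(X)=\big(\bigcup_j(QX_j+\mathcal D_{ij})\big)_{i\le m}$. Suppose that every cluster of $\Lambda$ is legal: for every family $P=(P_i)_{i\le m}$ of finite sets $P_i\subset\Lambda_i$ there are $k\ge1$, $a\in\mathbb R^d$, $j\le m$ and $x\in\Lambda_j$ with $a+P\subset\Phi^k(x)$, where $x$ stands for the family with the single point $x$ in colour $j$. Let $\Xi=\bigcup_i(\Lambda_i-\Lambda_i)$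 and suppose that $\Lambda$ admits an algebraic coincidence: there are $M\ge1$, $i\le m$ and $\xi\in\Lambda_i$ with $\xi+Q^M\Xi\subset\Lambda_i$. Let $L$ be the subgroup of $\mathbb R^d$ generated by $\bigcup_i\Lambda_i$ and $\mathcal K=\{x\in\mathbb R^d:\Lambda+x=\Lambda\}$. Let $(F_n)$ be a van Hove sequence, i.e. bounded measurable sets of positive volume with $\mathrm{Vol}(\{x:\mathrm{dist}(x,\partial F_n)\le r\})/\mathrm{Vol}(F_n)\to0$ for every $r>0$, and for $\epsilon>0$ let $$P_\epsilon=\Big\{x\in L:\ \limsup_{n\to\infty}\frac{\sum_{i}\#\big(((x+\Lambda_i)\,\triangle\,\Lambda_i)\cap F_n\big)}{\mathrm{Vol}(F_n)}<\epsilon\Big\}.$$ Then there is a (unique) group topology on $L$ with neighbourhood base $\{\alpha+Q^n\Xi+\mathcal K: n\ge1\}$ at each $\alpha\in L$ (the $Q$-topology; write $L_Q$), and a (unique) group topology on $L$ with neighbourhood base $\{\alpha+P_\epsilon:\epsilon>0\}$ at each $\alpha\in L$ (the $P_\epsilon$-topology; write $L_P$). The identity map $L_Q\to L_P$ and the identity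 map $L_P\to L_Q$ are both uniformly continuous. Hence the two topologies coincide, and the identity of $L$ induces an isomorphism of topological groups, uniformly continuous in both directions, from the Hausdorff completion $H$ of $L_Q$ onto the Hausdorff completion of $L_P$. -/

import Mathlib

open scoped Pointwise Topology ENNReal
open MeasureTheory Filter

/-! ### Delone multi-colour sets -/

/-- Euclidean space `ℝ^d`. -/
abbrev Euc (d : ℕ) : Type := EuclideanSpace ℝ (Fin d)

/-- An `m`-multi-colour set in `ℝ^d`: a family `(Λ_i)_{i ≤ m}` of subsets of `ℝ^d`. -/
abbrev MultiColourSet (d m : ℕ) : Type := Fin m → Set (Euc d)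

/-- A Delone set: a uniformly discrete and relatively dense set. -/
def IsDeloneSet {d : ℕ} (S : Set (Euc d)) : Prop :=
  ∃ D : Delone.DeloneSet (Euc d), D.carrier = S

/-- A Delone multi-colour set: every colour class and the support (the union of the colour
classes) are Delone sets. -/
def IsDeloneMulti {d m : ℕ} (Λ : MultiColourSet d m) : Prop :=
  (∀ i, IsDeloneSet (Λ i)) ∧ IsDeloneSet (⋃ i, Λ i)

/-- The translate `x + Λ = (x + Λ_i)_{i ≤ m}`. -/
def translateMulti {d m : ℕ} (x : Euc d) (Λ : MultiColourSet d m) : MultiColourSet d m :=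
  fun i => (fun y => x + y) '' Λ i

/-- `Ξ(Λ) = ⋃_i (Λ_i - Λ_i)`. -/
def Xi {d m : ℕ} (Λ : MultiColourSet d m) : Set (Euc d) :=
  ⋃ i, (Λ i - Λ i)

/-- The set `𝒦` of periods of `Λ`. -/
def periods {d m : ℕ} (Λ : MultiColourSet d m) : Set (Euc d) :=
  {x | translateMulti x Λ = Λ}

/-! ### Substitutions -/

/-- A linear map `Q` of `ℝ^d` is expansive if `c * e(x, y) ≤ e(Q x, Q y)` for some `c > 1` and
some metric `e` that induces the standard topology. -/
def IsExpansive {d : ℕ} (Q : Euc d →ₗ[ℝ] Euc d) : Prop :=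
  ∃ (c : ℝ) (e : MetricSpace (Euc d)),
    e.toUniformSpace.toTopologicalSpace = (inferInstance : TopologicalSpace (Euc d)) ∧
    1 < c ∧ ∀ x y, c * e.dist x y ≤ e.dist (Q x) (Q y)

/-- The matrix function system `Φ` given by `Q` and the digit sets `D_ij`, acting on multi-colour
sets: `Φ(X)_i = ⋃_j (Q X_j + D_ij)`. -/
def mfs {d m : ℕ} (Q : Euc d →ₗ[ℝ] Euc d) (D : Fin m → Fin m → Finset (Euc d))
    (X : MultiColourSet d m) : MultiColourSet d m :=
  fun i => ⋃ j, (Q '' X j + (D i j : Set (Euc d)))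

/-- The multi-colour set that consists of the single point `x` in colour `j`. -/
def onePoint {d m : ℕ} (j : Fin m) (x : Euc d) : MultiColourSet d m :=
  fun i => {y | i = j ∧ y = x}

/-- `Λ` is a substitution Delone multi-colour set with expansive map `Q` and digit sets `D_ij`:
it is a Delone multi-colour set, `Q` is expansive, and every `Λ_i` is the disjoint union of the
sets `Q Λ_j + a` over all `j ≤ m` and `a ∈ D_ij`. -/
structure IsSubstitutionDelone {d m : ℕ} (Λ : MultiColourSet d m) (Q : Euc d →ₗ[ℝ] Euc d)
    (D : Fin m → Fin m → Finset (Euc d)) : Prop where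
  delone : IsDeloneMulti Λ
  expansive : IsExpansive Q
  substitution : mfs Q D Λ = Λ
  disjoint : ∀ (i j j' : Fin m) (a a' : Euc d), a ∈ D i j → a' ∈ D i j' → (j, a) ≠ (j', a') →
    Disjoint ((fun x => Q x + a) '' Λ j) ((fun x => Q x + a') '' Λ j')

/-- The substitution matrix `S_ij = #D_ij`. -/
def substMatrix {d m : ℕ} (D : Fin m → Fin m → Finset (Euc d)) : Matrix (Fin m) (Fin m) ℝ :=
  Matrix.of fun i j => ((D i j).card : ℝ)

/-- A cluster `P = (P_i)_{i ≤ m}` is legal if `a + P ⊆ Φ^k(x)` for some `k ≥ 1`, some `a ∈ ℝ^d`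
and some point `x` of `Λ` (of colour `j`). -/
def IsLegal {d m : ℕ} (Λ : MultiColourSet d m) (Q : Euc d →ₗ[ℝ] Euc d)
    (D : Fin m → Fin m → Finset (Euc d)) (P : Fin m → Finset (Euc d)) : Prop :=
  ∃ (k : ℕ) (a : Euc d) (j : Fin m), 1 ≤ k ∧ ∃ x ∈ Λ j,
    ∀ i, ∀ p ∈ P i, a + p ∈ ((mfs Q D)^[k] (onePoint j x)) i

/-- Every cluster of `Λ` (a family of finite sets `P_i ⊆ Λ_i`) is legal. -/
def EveryClusterLegal {d m : ℕ} (Λ : MultiColourSet d m) (Q : Euc d →ₗ[ℝ] Euc d)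
    (D : Fin m → Fin m → Finset (Euc d)) : Prop :=
  ∀ P : Fin m → Finset (Euc d), (∀ i, (P i : Set (Euc d)) ⊆ Λ i) → IsLegal Λ Q D P

/-- Algebraic coincidence: `ξ + Q^M Ξ(Λ) ⊆ Λ_i` for some `M ≥ 1`, some `i` and some `ξ ∈ Λ_i`. -/
def AlgebraicCoincidence {d m : ℕ} (Λ : MultiColourSet d m) (Q : Euc d →ₗ[ℝ] Euc d) : Prop :=
  ∃ (M : ℕ) (i : Fin m) (ξ : Euc d), 1 ≤ M ∧ ξ ∈ Λ i ∧ ∀ z ∈ Xi Λ, ξ + (Q ^ M) z ∈ Λ i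

/-! ### Van Hove sequences and the autocorrelation pseudometric -/

/-- A van Hove sequence: bounded measurable sets `F_n` of positive volume with
`Vol((∂F_n)^{+r}) / Vol(F_n) → 0` for all `r > 0`, where `(∂F_n)^{+r}` is the set of the points at
distance at most `r` from `∂F_n`. -/
structure IsVanHove {d : ℕ} (F : ℕ → Set (Euc d)) : Prop where
  bounded : ∀ n, Bornology.IsBounded (F n)
  measurable : ∀ n, MeasurableSet (F n)
  pos : ∀ n, 0 < volume (F n)
  tendsto : ∀ r : ℝ, 0 < r →
    Tendsto (fun n => volume (Metric.cthickening r (frontier (F n))) / volume (F n)) atTop (𝓝 0)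

/-- `ρ(Λ', Λ'') = limsup_n (∑_i #((Λ'_i ∆ Λ''_i) ∩ F_n)) / Vol(F_n)`, as an element of
`[0, ∞]`. -/
noncomputable def rho {d m : ℕ} (F : ℕ → Set (Euc d)) (Λ' Λ'' : MultiColourSet d m) : ℝ≥0∞ :=
  limsup (fun n =>
    (∑ i, (((symmDiff (Λ' i) (Λ'' i) ∩ F n).encard : ℕ∞) : ℝ≥0∞)) / volume (F n)) atTop

/-! ### The group `L` and the two neighbourhood systems -/

/-- The group `L` generated by the sets `Λ_j`, `j ≤ m`. -/
def groupL {d m : ℕ} (Λ : MultiColourSet d m) : AddSubgroup (Euc d) :=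
  AddSubgroup.closure (⋃ j, Λ j)

/-- `Q^n Ξ(Λ) + 𝒦`, as a subset of `L`. -/
def qNhd {d m : ℕ} (Λ : MultiColourSet d m) (Q : Euc d →ₗ[ℝ] Euc d) (n : ℕ) : Set (groupL Λ) :=
  {x | ∃ z ∈ Xi Λ, ∃ k ∈ periods Λ, (x : Euc d) = (Q ^ n) z + k}

/-- `P_ε = {x ∈ L : ρ(x + Λ, Λ) < ε}`. -/
def pNhd {d m : ℕ} (Λ : MultiColourSet d m) (F : ℕ → Set (Euc d)) (ε : ℝ) : Set (groupL Λ) :=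
  {x | rho F (translateMulti (x : Euc d) Λ) Λ < ENNReal.ofReal ε}

/-- The sets `α + U i`, for `i` with `p i`, form a neighbourhood base at `α`, for every `α`. A
topology is determined by this property. -/
def HasNhdBase {G ι : Type*} [AddCommGroup G] (τ : AddGroupTopology G) (p : ι → Prop)
    (U : ι → Set G) : Prop :=
  ∀ α : G, (@nhds G τ.toTopologicalSpace α).HasBasis p fun i => (fun x => α + x) '' U i

/-- `τ` is the `Q`-topology on `L`: the group topology with the neighbourhood base
`{α + Q^n Ξ(Λ) + 𝒦 : n ≥ 1, α ∈ L}`. -/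
def IsQTopology {d m : ℕ} (Λ : MultiColourSet d m) (Q : Euc d →ₗ[ℝ] Euc d)
    (τ : AddGroupTopology (groupL Λ)) : Prop :=
  HasNhdBase τ (fun n : ℕ => 1 ≤ n) (qNhd Λ Q)

/-- `τ` is the `P_ε`-topology on `L`: the group topology with the neighbourhood base
`{α + P_ε : ε > 0, α ∈ L}`. -/
def IsPTopology {d m : ℕ} (Λ : MultiColourSet d m) (F : ℕ → Set (Euc d))
    (τ : AddGroupTopology (groupL Λ)) : Prop :=
  HasNhdBase τ (fun ε : ℝ => 0 < ε) (pNhd Λ F)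

/-! ### Uniform structure and Hausdorff completion of a topological abelian group -/

/-- The uniform structure of a topological abelian group. -/
abbrev groupUniformity {G : Type*} [AddCommGroup G] (τ : AddGroupTopology G) : UniformSpace G :=
  @IsTopologicalAddGroup.rightUniformSpace G _ τ.toTopologicalSpace τ.toIsTopologicalAddGroup

instance isUniformAddGroup_groupUniformity {G : Type*} [AddCommGroup G] (τ : AddGroupTopology G) :
    @IsUniformAddGroup G (groupUniformity τ) _ :=
  @isUniformAddGroup_of_addCommGroup G _ τ.toTopologicalSpace τ.toIsTopologicalAddGroup

/-- The Hausdorff completion of the topological abelian group `(G, τ)`, with the group structure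
and the uniform structure that Mathlib puts on it. -/
abbrev HausdorffCompletion {G : Type*} [AddCommGroup G] (τ : AddGroupTopology G) : Type _ :=
  @UniformSpace.Completion G (groupUniformity τ)

/-- The canonical map of `G` into its Hausdorff completion. -/
abbrev toHausdorffCompletion {G : Type*} [AddCommGroup G] (τ : AddGroupTopology G) (x : G) :
    HausdorffCompletion τ :=
  @UniformSpace.Completion.coe' G (groupUniformity τ) x

/-! Everything is done for a power of the substitution (`exists_strongSubstitution`) that doubles
lengths, has no empty digit set, and gives every point of Λ a child y of one fixed colour i₀ with y
+ QΞ ⊆ Λ_{i₀}. The coincidence yields Q(Ξ + Ξ) ⊆ Ξ, so the sets Q^nΞ + 𝒦 define a group topology;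
for the P_ε this follows from translation invariance of ρ. It remains to compare the two bases.

Small in Q implies small in ρ (`exists_rho_pow_lt`): delete one coincidence digit from each column.
A point y of colour i with y + Q^kΞ ⊄ Λ_i has an address of length k without deleted digits. The
tile volumes are a left eigenvector of the digit matrix for |det Q|, so only O((θ|det Q|)^k) such
addresses remain, with θ < 1. Each describes an affine copy of some Λ_j of density O(|det Q|^{-k}).
Hence ρ(Q^k z + Λ, Λ) = O(θ^k), uniformly in z ∈ Ξ.

Small in ρ implies small in Q (`exists_mem_xiNhd_of_rho_lt`): if ρ(x + Λ, Λ) is small, then x + Λ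
and Λ agree on a large ball. By repetitivity and finite local complexity, translates agreeing with Λ
on a large ball inflated by Q^n fall into boundedly many classes modulo Q^nΞ + 𝒦, with a bound
independent of n (`exists_card_bound`). An extremal choice of this number gives Q^p x ∈ Q^nΞ + 𝒦
with p independent of n. To cancel Q^p, write Q^p x = Q^{N+p}z + k; then l = x - Q^N z lies in one
of finitely many classes modulo 𝒦, ρ vanishes only on 𝒦, and ρ(l + Λ, Λ) is small by the first half,
so l ∈ 𝒦.

Tiles also enter through repetitivity: legality only places a cluster inside a supertile, and
measure disjointness of the tiles turns this inclusion into equality on a ball (`mem_of_translate`).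
-/

/-! ### Iterated digit sets -/

open Classical in
/-- The digit sets of the `k`-th power of the matrix function system given by `Q` and `D`. -/
noncomputable def dig {d m : ℕ} (Q : Euc d →ₗ[ℝ] Euc d) (D : Fin m → Fin m → Finset (Euc d)) :
    ℕ → Fin m → Fin m → Finset (Euc d)
  | 0 => fun i j => if i = j then {0} else ∅
  | k + 1 => fun i j =>
      Finset.univ.biUnion fun l => (D i l).biUnion fun b => (dig Q D k l j).image fun e => b + Q e

section Digits

variable {d m : ℕ} {Λ : MultiColourSet d m} {Q : Euc d →ₗ[ℝ] Euc d}
  {D : Fin m → Fin m → Finset (Euc d)}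

theorem mem_dig_zero {i j : Fin m} {a : Euc d} : a ∈ dig Q D 0 i j ↔ i = j ∧ a = 0 := by
  by_cases h : i = j <;> simp [dig, h]

theorem mem_dig_succ {k : ℕ} {i j : Fin m} {a : Euc d} :
    a ∈ dig Q D (k + 1) i j ↔ ∃ l, ∃ b ∈ D i l, ∃ e ∈ dig Q D k l j, a = b + Q e := by
  simp only [dig, Finset.mem_biUnion, Finset.mem_univ, true_and, Finset.mem_image]
  grind

theorem mem_dig_add {s t : ℕ} {i j : Fin m} {a : Euc d} :
    a ∈ dig Q D (s + t) i j ↔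
      ∃ l, ∃ e ∈ dig Q D s i l, ∃ b ∈ dig Q D t l j, a = e + (Q ^ s) b := by
  induction s generalizing i a with
  | zero => simp [mem_dig_zero]
  | succ s ih =>
    rw [show s + 1 + t = (s + t) + 1 by ring]
    simp only [mem_dig_succ, ih, pow_succ', Module.End.mul_apply]
    constructor
    · rintro ⟨l, b, hb, e, ⟨l', e', he', b', hb', rfl⟩, rfl⟩
      exact ⟨l', b + Q e', ⟨l, b, hb, e', he', rfl⟩, b', hb', by rw [map_add, add_assoc]⟩
    · rintro ⟨l', _, ⟨l, b, hb, e', he', rfl⟩, b', hb', rfl⟩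
      exact ⟨l, b, hb, _, ⟨l', e', he', b', hb', rfl⟩, by rw [map_add, add_assoc]⟩

theorem dig_one (i j : Fin m) : dig Q D 1 i j = D i j := by
  ext a
  simp only [mem_dig_succ (k := 0), mem_dig_zero]
  constructor
  · rintro ⟨l, b, hb, e, ⟨rfl, rfl⟩, rfl⟩
    simpa using hb
  · intro h
    exact ⟨j, a, h, 0, ⟨rfl, rfl⟩, by simp⟩

theorem mem_dig_mul {q k : ℕ} {i j : Fin m} {a : Euc d} :
    a ∈ dig (Q ^ q) (dig Q D q) k i j ↔ a ∈ dig Q D (q * k) i j := by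
  induction k generalizing i a with
  | zero => simp [mem_dig_zero]
  | succ k ih =>
    rw [mem_dig_succ, show q * (k + 1) = q + q * k by ring, mem_dig_add]
    simp only [ih]

theorem mem_mfs {X : MultiColourSet d m} {i : Fin m} {y : Euc d} :
    y ∈ mfs Q D X i ↔ ∃ j, ∃ u ∈ X j, ∃ a ∈ D i j, y = Q u + a := by
  simp only [mfs, Set.mem_iUnion, Set.mem_add, Set.mem_image, Finset.mem_coe]
  grind

theorem mem_mfs_iterate {k : ℕ} {X : MultiColourSet d m} {i : Fin m} {y : Euc d} :
    y ∈ ((mfs Q D)^[k] X) i ↔ ∃ j, ∃ u ∈ X j, ∃ a ∈ dig Q D k i j, y = (Q ^ k) u + a := by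
  induction k generalizing i y with
  | zero => simp [mem_dig_zero]
  | succ k ih =>
    rw [Function.iterate_succ_apply', mem_mfs]
    simp only [ih, mem_dig_succ, pow_succ', Module.End.mul_apply]
    constructor
    · rintro ⟨l, _, ⟨j, u, hu, e, he, rfl⟩, b, hb, rfl⟩
      exact ⟨j, u, hu, _, ⟨l, b, hb, e, he, rfl⟩, by rw [map_add]; abel⟩
    · rintro ⟨j, u, hu, _, ⟨l, b, hb, e, he, rfl⟩, rfl⟩
      exact ⟨l, _, ⟨j, u, hu, e, he, rfl⟩, b, hb, by rw [map_add]; abel⟩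

theorem mem_mfs_iterate_onePoint {k : ℕ} {i j : Fin m} {x y : Euc d} :
    y ∈ ((mfs Q D)^[k] (onePoint j x)) i ↔ ∃ a ∈ dig Q D k i j, y = (Q ^ k) x + a := by
  rw [mem_mfs_iterate]
  constructor
  · rintro ⟨_, _, ⟨rfl, rfl⟩, h⟩
    exact h
  · exact fun h => ⟨j, x, ⟨rfl, rfl⟩, h⟩

theorem mem_iff_exists_dig (h : mfs Q D Λ = Λ) (k : ℕ) {i : Fin m} {y : Euc d} :
    y ∈ Λ i ↔ ∃ j, ∃ u ∈ Λ j, ∃ a ∈ dig Q D k i j, y = (Q ^ k) u + a := by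
  rw [← mem_mfs_iterate, Function.iterate_fixed h]

theorem dig_nonempty_of_pow_pos {k : ℕ} {i j : Fin m} (h : (substMatrix D ^ k) i j ≠ 0) :
    (dig Q D k i j).Nonempty := by
  induction k generalizing i with
  | zero =>
    have : i = j := by
      by_contra hne
      simp [hne] at h
    exact ⟨0, mem_dig_zero.2 ⟨this, rfl⟩⟩
  | succ k ih =>
    rw [pow_succ', Matrix.mul_apply] at h
    obtain ⟨l, -, hl⟩ := Finset.exists_ne_zero_of_sum_ne_zero h
    obtain ⟨e, he⟩ := ih (right_ne_zero_of_mul hl)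
    have : (D i l).Nonempty := by
      rw [← Finset.card_ne_zero]
      intro h0
      exact left_ne_zero_of_mul hl (by simp [substMatrix, h0])
    obtain ⟨b, hb⟩ := this
    exact ⟨_, mem_dig_succ.2 ⟨l, b, hb, e, he, rfl⟩⟩

/-- The points of the supertiles of level `k` determine their labels. -/
theorem dig_unique
    (hD : ∀ (i j j' : Fin m) (a a' u u' : Euc d), a ∈ D i j → a' ∈ D i j' → u ∈ Λ j → u' ∈ Λ j' →
      Q u + a = Q u' + a' → j = j' ∧ a = a')
    (hQ : Function.Injective Q) (hΛ : mfs Q D Λ = Λ) (k : ℕ) (i j j' : Fin m)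
    (a a' u u' : Euc d) (ha : a ∈ dig Q D k i j) (ha' : a' ∈ dig Q D k i j')
    (hu : u ∈ Λ j) (hu' : u' ∈ Λ j') (h : (Q ^ k) u + a = (Q ^ k) u' + a') :
    j = j' ∧ a = a' := by
  induction k generalizing i a a' with
  | zero =>
    rw [mem_dig_zero] at ha ha'
    exact ⟨ha.1.symm.trans ha'.1, ha.2.trans ha'.2.symm⟩
  | succ k ih =>
    obtain ⟨l, b, hb, e, he, rfl⟩ := mem_dig_succ.1 ha
    obtain ⟨l', b', hb', e', he', rfl⟩ := mem_dig_succ.1 ha'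
    have hy : (Q ^ k) u + e ∈ Λ l := (mem_iff_exists_dig hΛ k).2 ⟨j, u, hu, e, he, rfl⟩
    have hy' : (Q ^ k) u' + e' ∈ Λ l' := (mem_iff_exists_dig hΛ k).2 ⟨j', u', hu', e', he', rfl⟩
    have key : Q ((Q ^ k) u + e) + b = Q ((Q ^ k) u' + e') + b' := by
      simp only [pow_succ', Module.End.mul_apply] at h
      rw [map_add, map_add, add_assoc, add_comm (Q e), h]
      abel
    obtain ⟨rfl, rfl⟩ := hD i l l' b b' _ _ hb hb' hy hy' key
    obtain ⟨rfl, rfl⟩ := ih l e e' he he' (hQ (add_right_cancel key))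
    exact ⟨rfl, rfl⟩

theorem card_dig_succ_le (k : ℕ) (i j : Fin m) :
    (dig Q D (k + 1) i j).card ≤ ∑ l, (D i l).card * (dig Q D k l j).card := by
  classical
  refine Finset.card_biUnion_le.trans (Finset.sum_le_sum fun l _ => ?_)
  exact Finset.card_biUnion_le_card_mul _ _ _ fun b _ => Finset.card_image_le

/-- Applied to one point of Λ_j, distinct addresses land in disjoint pieces of Λ, so they give
distinct digits. Equality, not just `card_dig_succ_le`, is what `eq_of_subinvariant` needs. -/
theorem card_dig_succ
    (hD : ∀ (i j j' : Fin m) (a a' u u' : Euc d), a ∈ D i j → a' ∈ D i j' → u ∈ Λ j → u' ∈ Λ j' →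
      Q u + a = Q u' + a' → j = j' ∧ a = a')
    (hQ : Function.Injective Q) (hΛ : mfs Q D Λ = Λ) (k : ℕ) (i j : Fin m)
    (hj : (Λ j).Nonempty) :
    (dig Q D (k + 1) i j).card = ∑ l, (D i l).card * (dig Q D k l j).card := by
  classical
  obtain ⟨x, hx⟩ := hj
  have key : ∀ l l' b b' e e', b ∈ D i l → b' ∈ D i l' → e ∈ dig Q D k l j → e' ∈ dig Q D k l' j →
      b + Q e = b' + Q e' → l = l' ∧ b = b' ∧ e = e' := by
    intro l l' b b' e e' hb hb' he he' h
    have hy : (Q ^ k) x + e ∈ Λ l := (mem_iff_exists_dig hΛ k).2 ⟨j, x, hx, e, he, rfl⟩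
    have hy' : (Q ^ k) x + e' ∈ Λ l' := (mem_iff_exists_dig hΛ k).2 ⟨j, x, hx, e', he', rfl⟩
    obtain ⟨rfl, rfl⟩ := hD i l l' b b' _ _ hb hb' hy hy' (by
      rw [map_add, map_add, add_assoc, add_assoc, add_comm (Q e), add_comm (Q e'), h])
    exact ⟨rfl, rfl, hQ (add_left_cancel h)⟩
  rw [dig, Finset.card_biUnion]
  · refine Finset.sum_congr rfl fun l _ => ?_
    rw [Finset.card_biUnion]
    · simp_rw [Finset.card_image_of_injective _
        (fun e e' h => hQ (add_left_cancel h) : Function.Injective fun e => _ + Q e)]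
      simp
    · intro b hb b' hb' hne
      rw [Function.onFun, Finset.disjoint_left]
      simp only [Finset.mem_image, not_exists, not_and]
      rintro _ ⟨e, he, rfl⟩ e' he' h
      exact hne (key l l b b' e e' hb hb' he he' h.symm).2.1
  · intro l _ l' _ hne
    rw [Function.onFun, Finset.disjoint_left]
    simp only [Finset.mem_biUnion, Finset.mem_image, not_exists, not_and]
    rintro _ ⟨b, hb, e, he, rfl⟩ b' hb' e' he' h
    exact hne (key l l' b b' e e' hb hb' he he' h.symm).1

end Digits

/-- A substitution Delone multi-colour set whose inflation doubles lengths, whose digit sets are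
all nonempty, all of whose clusters occur in the supertiles of some level, and for which every
point has a child `y` with `y + Q Ξ(Λ) ⊆ Λ`. -/
structure IsStrongSubstitution {d m : ℕ} (Λ : MultiColourSet d m) (Q : Euc d →ₗ[ℝ] Euc d)
    (D : Fin m → Fin m → Finset (Euc d)) : Prop where
  fixed : mfs Q D Λ = Λ
  unique : ∀ (i j j' : Fin m) (a a' u u' : Euc d), a ∈ D i j → a' ∈ D i j' → u ∈ Λ j → u' ∈ Λ j' →
    Q u + a = Q u' + a' → j = j' ∧ a = a'
  separated : ∃ r : ℝ, 0 < r ∧ ∀ i, ∀ u ∈ Λ i, ∀ v ∈ Λ i, u ≠ v → r ≤ dist u v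
  dense : ∃ R : ℝ, 0 < R ∧ ∀ (i : Fin m) (p : Euc d), ∃ u ∈ Λ i, ‖u - p‖ ≤ R
  expand : ∀ v, 2 * ‖v‖ ≤ ‖Q v‖
  nonempty : ∀ i j, (D i j).Nonempty
  legal : ∀ P : Fin m → Finset (Euc d), (∀ i, (P i : Set (Euc d)) ⊆ Λ i) →
    ∃ k, ∀ j, ∃ a, ∀ i, ∀ p ∈ P i, a + p ∈ dig Q D k i j
  good : ∃ i₀, ∀ j, ∃ a ∈ D i₀ j, ∀ u ∈ Λ j, ∀ z ∈ Xi Λ, Q u + a + Q z ∈ Λ i₀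

/-- The set `Q^n Ξ(Λ) + 𝒦`. -/
def xiNhd {d m : ℕ} (Λ : MultiColourSet d m) (Q : Euc d →ₗ[ℝ] Euc d) (n : ℕ) : Set (Euc d) :=
  {x | ∃ z ∈ Xi Λ, ∃ k ∈ periods Λ, x = (Q ^ n) z + k}

/-! ### Periods, the sets Q^nΞ + 𝒦, and bounds for strong substitutions. -/

section Basic

variable {d m : ℕ} {Λ : MultiColourSet d m} {Q : Euc d →ₗ[ℝ] Euc d}
  {D : Fin m → Fin m → Finset (Euc d)}

theorem mem_translateMulti {x y : Euc d} {i : Fin m} :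
    y ∈ translateMulti x Λ i ↔ y - x ∈ Λ i := by
  simp only [translateMulti, Set.mem_image]
  constructor
  · rintro ⟨z, hz, rfl⟩
    simpa using hz
  · exact fun h => ⟨_, h, by abel⟩

theorem mem_periods {x : Euc d} : x ∈ periods Λ ↔ ∀ i y, y - x ∈ Λ i ↔ y ∈ Λ i := by
  simp only [periods, Set.mem_ofPred_eq, funext_iff, Set.ext_iff, mem_translateMulti]

/-- The subgroup of periods. -/
def periodGroup (Λ : MultiColourSet d m) : AddSubgroup (Euc d) where
  carrier := periods Λ
  zero_mem' := mem_periods.2 fun i y => by simp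
  add_mem' {a b} ha hb := mem_periods.2 fun i y => by
    rw [← sub_sub, mem_periods.1 hb, mem_periods.1 ha]
  neg_mem' {a} ha := mem_periods.2 fun i y => by
    rw [← mem_periods.1 ha i (y - -a), sub_neg_eq_add, add_sub_cancel_right]

theorem map_mem_periods (hΛ : mfs Q D Λ = Λ) {x : Euc d} (hx : x ∈ periods Λ) :
    Q x ∈ periods Λ := by
  have key : ∀ x ∈ periods Λ, ∀ i y, y ∈ Λ i → y + Q x ∈ Λ i := by
    intro x hx i y hy
    rw [← hΛ, mem_mfs] at hy ⊢
    obtain ⟨j, u, hu, a, ha, rfl⟩ := hy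
    refine ⟨j, u + x, ?_, a, ha, by rw [map_add]; abel⟩
    rw [← mem_periods.1 hx]
    simpa using hu
  rw [mem_periods]
  intro i y
  constructor
  · intro h
    simpa using key x hx i _ h
  · intro h
    simpa [sub_eq_add_neg] using key (-x) ((periodGroup Λ).neg_mem hx) i _ h

theorem pow_map_mem_periods (hΛ : mfs Q D Λ = Λ) (n : ℕ) {x : Euc d} (hx : x ∈ periods Λ) :
    (Q ^ n) x ∈ periods Λ := by
  induction n with
  | zero => simpa using hx
  | succ n ih =>
    rw [pow_succ', Module.End.mul_apply]
    exact map_mem_periods hΛ ih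

theorem mem_Xi {z : Euc d} : z ∈ Xi Λ ↔ ∃ i, ∃ u ∈ Λ i, ∃ v ∈ Λ i, z = u - v := by
  simp only [Xi, Set.mem_iUnion, Set.mem_sub]
  grind

theorem sub_mem_Xi {i : Fin m} {u v : Euc d} (hu : u ∈ Λ i) (hv : v ∈ Λ i) : u - v ∈ Xi Λ :=
  mem_Xi.2 ⟨i, u, hu, v, hv, rfl⟩

theorem neg_mem_Xi {z : Euc d} (hz : z ∈ Xi Λ) : -z ∈ Xi Λ := by
  obtain ⟨i, u, hu, v, hv, rfl⟩ := mem_Xi.1 hz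
  rw [neg_sub]
  exact sub_mem_Xi hv hu

theorem map_mem_Xi (hΛ : mfs Q D Λ = Λ) (hne : ∀ j, ∃ i, (D i j).Nonempty) {z : Euc d}
    (hz : z ∈ Xi Λ) : Q z ∈ Xi Λ := by
  obtain ⟨j, u, hu, v, hv, rfl⟩ := mem_Xi.1 hz
  obtain ⟨i, a, ha⟩ := hne j
  have h : ∀ w ∈ Λ j, Q w + a ∈ Λ i := fun w hw => by
    rw [← hΛ, mem_mfs]
    exact ⟨j, w, hw, a, ha, rfl⟩
  have := sub_mem_Xi (h u hu) (h v hv)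
  rwa [add_sub_add_right_eq_sub, ← map_sub] at this

theorem pow_map_mem_Xi (hΛ : mfs Q D Λ = Λ) (hne : ∀ j, ∃ i, (D i j).Nonempty) (n : ℕ) {z : Euc d}
    (hz : z ∈ Xi Λ) : (Q ^ n) z ∈ Xi Λ := by
  induction n with
  | zero => simpa using hz
  | succ n ih =>
    rw [pow_succ', Module.End.mul_apply]
    exact map_mem_Xi hΛ hne ih

theorem exists_norm_pow_le (Q : Euc d →ₗ[ℝ] Euc d) (n : ℕ) :
    ∃ C : ℝ, 1 ≤ C ∧ ∀ v, ‖(Q ^ n) v‖ ≤ C * ‖v‖ := by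
  refine ⟨max 1 ‖LinearMap.toContinuousLinearMap (Q ^ n)‖, le_max_left _ _, fun v => ?_⟩
  exact ((LinearMap.toContinuousLinearMap (Q ^ n)).le_opNorm v).trans
    (mul_le_mul_of_nonneg_right (le_max_right _ _) (norm_nonneg v))

theorem xiNhd_anti (hΛ : mfs Q D Λ = Λ) (hne : ∀ j, ∃ i, (D i j).Nonempty) :
    Antitone (xiNhd Λ Q) := by
  intro n n' hn x
  rintro ⟨z, hz, k, hk, rfl⟩
  obtain ⟨t, rfl⟩ := Nat.exists_eq_add_of_le hn
  exact ⟨(Q ^ t) z, pow_map_mem_Xi hΛ hne t hz, k, hk, by rw [pow_add, Module.End.mul_apply]⟩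

theorem neg_mem_xiNhd {n : ℕ} {x : Euc d} (hx : x ∈ xiNhd Λ Q n) : -x ∈ xiNhd Λ Q n := by
  obtain ⟨z, hz, k, hk, rfl⟩ := hx
  exact ⟨-z, neg_mem_Xi hz, -k, (periodGroup Λ).neg_mem hk, by rw [map_neg]; abel⟩

theorem pow_map_mem_xiNhd {n : ℕ} {z : Euc d} (hz : z ∈ Xi Λ) : (Q ^ n) z ∈ xiNhd Λ Q n :=
  ⟨z, hz, 0, (periodGroup Λ).zero_mem, by simp⟩

namespace IsStrongSubstitution

theorem norm_le_norm_pow (h : IsStrongSubstitution Λ Q D) (n : ℕ) (v : Euc d) :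
    ‖v‖ ≤ ‖(Q ^ n) v‖ := by
  induction n with
  | zero => simp
  | succ n ih =>
    rw [pow_succ', Module.End.mul_apply]
    linarith [h.expand ((Q ^ n) v), norm_nonneg ((Q ^ n) v)]

theorem pow_injective (h : IsStrongSubstitution Λ Q D) (n : ℕ) : Function.Injective (Q ^ n) := by
  rw [injective_iff_map_eq_zero]
  intro v hv
  simpa [hv] using h.norm_le_norm_pow n v

theorem pow_surjective (h : IsStrongSubstitution Λ Q D) (n : ℕ) : Function.Surjective (Q ^ n) :=
  LinearMap.injective_iff_surjective.1 (h.pow_injective n)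

theorem injective (h : IsStrongSubstitution Λ Q D) : Function.Injective Q := by
  simpa using h.pow_injective 1

theorem surjective (h : IsStrongSubstitution Λ Q D) : Function.Surjective Q :=
  LinearMap.injective_iff_surjective.1 h.injective

theorem exists_nonempty (h : IsStrongSubstitution Λ Q D) (j : Fin m) : ∃ i, (D i j).Nonempty :=
  ⟨j, h.nonempty j j⟩

theorem set_nonempty (h : IsStrongSubstitution Λ Q D) (j : Fin m) : (Λ j).Nonempty := by
  obtain ⟨R, -, hR⟩ := h.dense
  obtain ⟨u, hu, -⟩ := hR j 0
  exact ⟨u, hu⟩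

theorem mem_of_dig (h : IsStrongSubstitution Λ Q D) {k : ℕ} {i j : Fin m} {u a : Euc d}
    (hu : u ∈ Λ j) (ha : a ∈ dig Q D k i j) : (Q ^ k) u + a ∈ Λ i :=
  (mem_iff_exists_dig h.fixed k).2 ⟨j, u, hu, a, ha, rfl⟩

theorem exists_coincidence (h : IsStrongSubstitution Λ Q D) :
    ∃ i, ∃ ξ ∈ Λ i, ∀ z ∈ Xi Λ, ξ + Q z ∈ Λ i := by
  obtain ⟨i₀, hi₀⟩ := h.good
  obtain ⟨a, ha, hg⟩ := hi₀ i₀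
  obtain ⟨u, hu⟩ := h.set_nonempty i₀
  refine ⟨i₀, Q u + a, ?_, hg u hu⟩
  rw [← h.fixed, mem_mfs]
  exact ⟨i₀, u, hu, a, ha, rfl⟩

/-- Q(z + w) is the difference of ξ + Qz and ξ + Q(-w), both in Λ_i. Thus an addition in the sets
Q^nΞ + 𝒦 costs one level. -/
theorem map_add_mem_Xi (h : IsStrongSubstitution Λ Q D) {z w : Euc d} (hz : z ∈ Xi Λ)
    (hw : w ∈ Xi Λ) : Q (z + w) ∈ Xi Λ := by
  obtain ⟨i, ξ, -, hg⟩ := h.exists_coincidence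
  have := sub_mem_Xi (hg z hz) (hg _ (neg_mem_Xi hw))
  rwa [add_sub_add_left_eq_sub, ← map_sub, sub_neg_eq_add] at this

theorem add_mem_xiNhd (h : IsStrongSubstitution Λ Q D) {n : ℕ} {x y : Euc d}
    (hx : x ∈ xiNhd Λ Q (n + 1)) (hy : y ∈ xiNhd Λ Q (n + 1)) : x + y ∈ xiNhd Λ Q n := by
  obtain ⟨z, hz, k, hk, rfl⟩ := hx
  obtain ⟨w, hw, l, hl, rfl⟩ := hy
  refine ⟨_, h.map_add_mem_Xi hz hw, k + l, (periodGroup Λ).add_mem hk hl, ?_⟩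
  simp only [pow_succ, Module.End.mul_apply, map_add]
  abel

theorem sub_mem_xiNhd (h : IsStrongSubstitution Λ Q D) {n : ℕ} {x y : Euc d}
    (hx : x ∈ xiNhd Λ Q (n + 1)) (hy : y ∈ xiNhd Λ Q (n + 1)) : x - y ∈ xiNhd Λ Q n := by
  rw [sub_eq_add_neg]
  exact h.add_mem_xiNhd hx (neg_mem_xiNhd hy)

theorem xiNhd_antitone (h : IsStrongSubstitution Λ Q D) : Antitone (xiNhd Λ Q) :=
  xiNhd_anti h.fixed h.exists_nonempty

/-- Digits of level `k` are images under `Q ^ k` of vectors in a fixed ball. -/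
theorem exists_dig_bound (h : IsStrongSubstitution Λ Q D) :
    ∃ κ : ℝ, 0 < κ ∧ (∀ i j, ∀ a ∈ D i j, ‖a‖ ≤ κ) ∧
      ∀ k i j, ∀ a ∈ dig Q D k i j, ∃ b, a = (Q ^ k) b ∧ ‖b‖ ≤ κ := by
  obtain ⟨κ, hκ0, hκ⟩ : ∃ κ : ℝ, 0 < κ ∧ ∀ i j, ∀ a ∈ D i j, ‖a‖ ≤ κ := by
    refine ⟨1 + ∑ i, ∑ j, ∑ a ∈ D i j, ‖a‖, by positivity, fun i j a ha => ?_⟩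
    have h1 : ‖a‖ ≤ ∑ a ∈ D i j, ‖a‖ :=
      Finset.single_le_sum (f := fun a => ‖a‖) (fun _ _ => norm_nonneg _) ha
    have h2 : ∑ a ∈ D i j, ‖a‖ ≤ ∑ j, ∑ a ∈ D i j, ‖a‖ :=
      Finset.single_le_sum (f := fun j => ∑ a ∈ D i j, ‖a‖) (fun _ _ => by positivity)
        (Finset.mem_univ j)
    have h3 : ∑ j, ∑ a ∈ D i j, ‖a‖ ≤ ∑ i, ∑ j, ∑ a ∈ D i j, ‖a‖ :=
      Finset.single_le_sum (f := fun i => ∑ j, ∑ a ∈ D i j, ‖a‖) (fun _ _ => by positivity)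
        (Finset.mem_univ i)
    linarith
  refine ⟨κ, hκ0, hκ, fun k => ?_⟩
  induction k with
  | zero =>
    intro i j a ha
    obtain ⟨-, rfl⟩ := mem_dig_zero.1 ha
    exact ⟨0, by simp, by simpa using hκ0.le⟩
  | succ k ih =>
    intro i j a ha
    obtain ⟨l, e, he, b, hb, rfl⟩ := mem_dig_add.1 ha
    rw [dig_one] at hb
    obtain ⟨e', rfl, he'⟩ := ih i l e he
    -- Doubling gives ‖c‖ ≤ (κ + κ)/2, so the bound κ reproduces itself.
    obtain ⟨c, hc⟩ := h.surjective (e' + b)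
    refine ⟨c, by rw [pow_succ, Module.End.mul_apply, hc, map_add], ?_⟩
    have h1 := h.expand c
    rw [hc] at h1
    linarith [norm_add_le e' b, hκ l j b hb]

theorem finite_inter_closedBall (h : IsStrongSubstitution Λ Q D) (i : Fin m) (p : Euc d) (R : ℝ) :
    (Λ i ∩ Metric.closedBall p R).Finite := by
  obtain ⟨r, hr, hsep⟩ := h.separated
  by_contra hinf
  have hinf : (Λ i ∩ Metric.closedBall p R).Infinite := hinf
  obtain ⟨x, -, hx⟩ := hinf.exists_accPt_of_subset_isCompact (isCompact_closedBall p R)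
    Set.inter_subset_right
  rw [accPt_iff_frequently] at hx
  obtain ⟨y, ⟨hyx, hy⟩, hyb⟩ := (hx.and_eventually (Metric.ball_mem_nhds x (half_pos hr))).exists
  obtain ⟨y', ⟨hyx', hy'⟩, hyb'⟩ := (hx.and_eventually
    (Metric.ball_mem_nhds x (dist_pos.2 hyx))).exists
  have hyb2 : dist y' x < dist y x := hyb'
  have hne : y ≠ y' := by
    rintro rfl
    exact lt_irrefl _ hyb2
  have := hsep i y hy.1 y' hy'.1 hne
  have hyb : dist y x < r / 2 := hyb
  linarith [dist_triangle_right y y' x]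

theorem countable_set (h : IsStrongSubstitution Λ Q D) (i : Fin m) : (Λ i).Countable := by
  have : Λ i = ⋃ n : ℕ, Λ i ∩ Metric.closedBall 0 n := by
    rw [← Set.inter_iUnion, Metric.iUnion_closedBall_nat, Set.inter_univ]
  rw [this]
  exact Set.countable_iUnion fun n => (h.finite_inter_closedBall i 0 n).countable

end IsStrongSubstitution

end Basic

/-! ### Tiles -/

/-- The compactness step for tiles: among finitely many candidates with nested conditions, one
witness serves all levels. -/
theorem exists_forall_of_antitone {ι : Type*} {s : Set ι} (hs : s.Finite) {P : ℕ → ι → Prop}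
    (hP : ∀ k l i, k ≤ l → P l i → P k i) (h : ∀ k, ∃ i ∈ s, P k i) : ∃ i ∈ s, ∀ k, P k i := by
  by_contra! hcon
  choose! k hk using hcon
  obtain ⟨i, hi, hPi⟩ := h (hs.toFinset.sup k)
  exact hk i hi (hP _ _ i (Finset.le_sup (f := k) (hs.mem_toFinset.2 hi)) hPi)

/-- A family of compact sets `A_j` with `Q A_j = ⋃_i (A_i + D_ij)` and `⋃_j (Λ_j + A_j) = ℝ^d`,
contained in the ball of radius `κ`, which also bounds the rescaled digits. -/
structure IsTileSystem {d m : ℕ} (Λ : MultiColourSet d m) (Q : Euc d →ₗ[ℝ] Euc d)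
    (D : Fin m → Fin m → Finset (Euc d)) (A : Fin m → Set (Euc d)) (κ : ℝ) : Prop where
  closed : ∀ j, IsClosed (A j)
  bound : ∀ j, ∀ y ∈ A j, ‖y‖ ≤ κ
  mem_iff : ∀ j y, y ∈ A j ↔ ∃ i, ∃ b ∈ D i j, Q y - b ∈ A i
  cover : ∀ p, ∃ j, ∃ u ∈ Λ j, p - u ∈ A j
  pos : 0 < κ
  dig_bound : ∀ k i j, ∀ a ∈ dig Q D k i j, ∃ b, a = (Q ^ k) b ∧ ‖b‖ ≤ κ

/-- The approximations of the tiles, starting from a ball. -/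
def tileApprox {d m : ℕ} (Q : Euc d →ₗ[ℝ] Euc d) (D : Fin m → Fin m → Finset (Euc d)) (κ : ℝ) :
    ℕ → Fin m → Set (Euc d)
  | 0 => fun _ => Metric.closedBall 0 κ
  | k + 1 => fun j => {y | ∃ i, ∃ b ∈ D i j, Q y - b ∈ tileApprox Q D κ k i}

/-- If a vector `v` satisfies `v S ≥ δ v` for a positive matrix `S` whose powers are `O(δ^k)`,
then `v S = δ v`. -/
theorem eq_of_subinvariant {m : ℕ} (S : Fin m → Fin m → ℝ) (N : ℕ → Fin m → Fin m → ℝ)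
    (v : Fin m → ℝ) (δ C : ℝ) (hδ : 0 < δ) (hS : ∀ i j, 1 ≤ S i j)
    (hN0 : ∀ i j, N 0 i j = if i = j then 1 else 0)
    (hN : ∀ k i j, N (k + 1) i j = ∑ l, S i l * N k l j)
    (hC : ∀ k i j, N k i j ≤ C * δ ^ k) (hv : ∀ i, 0 ≤ v i)
    (hsub : ∀ j, δ * v j ≤ ∑ i, v i * S i j) (j : Fin m) : ∑ i, v i * S i j = δ * v j := by
  by_contra hne
  have hlt : δ * v j < ∑ i, v i * S i j := lt_of_le_of_ne (hsub j) (Ne.symm hne)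
  -- Since all entries of S are at least 1, the excess γ in coordinate j reaches every coordinate of
  -- w S - δ w. Hence w S ≥ (1 + η) δ w, and w N_k grows at least like ((1 + η) δ)^k, against `hC`.
  set w : Fin m → ℝ := fun j => ∑ i, v i * S i j with hw
  have hw0 : ∀ i, 0 ≤ w i := fun i => (mul_nonneg hδ.le (hv i)).trans (hsub i)
  have hwj : 0 < w j := (mul_nonneg hδ.le (hv j)).trans_lt hlt
  have hNnn : ∀ k i l, 0 ≤ N k i l := by
    intro k
    induction k with
    | zero =>
      intro i l
      rw [hN0]
      split_ifs <;> norm_num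
    | succ k ih =>
      intro i l
      rw [hN]
      exact Finset.sum_nonneg fun l' _ => mul_nonneg (zero_le_one.trans (hS _ _)) (ih _ _)
  set γ := w j - δ * v j with hγ
  have hγ0 : 0 < γ := sub_pos.2 hlt
  set s := ∑ i, w i with hs
  have hsw : ∀ i, w i ≤ s := fun i =>
    Finset.single_le_sum (f := w) (fun i _ => hw0 i) (Finset.mem_univ i)
  have hs0 : 0 < s := hwj.trans_le (hsw j)
  set η := γ / (δ * s) with hη
  have hη0 : 0 < η := div_pos hγ0 (mul_pos hδ hs0)
  have hstep : ∀ l, (1 + η) * δ * w l ≤ ∑ i, w i * S i l := by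
    intro l
    have h1 : γ ≤ ∑ i, (w i - δ * v i) * S i l := by
      calc γ ≤ γ * S j l := le_mul_of_one_le_right hγ0.le (hS j l)
        _ ≤ _ := Finset.single_le_sum (f := fun i => (w i - δ * v i) * S i l)
          (fun i _ => mul_nonneg (sub_nonneg.2 (hsub i)) (zero_le_one.trans (hS i l)))
          (Finset.mem_univ j)
    have h2 : ∑ i, (w i - δ * v i) * S i l = ∑ i, w i * S i l - δ * w l := by
      simp only [sub_mul, Finset.sum_sub_distrib, hw, Finset.mul_sum, mul_assoc]
    have h3 : η * δ * w l ≤ γ := by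
      rw [hη, div_mul_eq_mul_div, div_mul_eq_mul_div, div_le_iff₀ (mul_pos hδ hs0)]
      have := mul_le_mul_of_nonneg_left (hsw l) (mul_nonneg hγ0.le hδ.le)
      linarith
    linarith
  have hgrow : ∀ k l, ((1 + η) * δ) ^ k * w l ≤ ∑ i, w i * N k i l := by
    intro k
    induction k with
    | zero => intro l; simp [hN0]
    | succ k ih =>
      intro l
      calc ((1 + η) * δ) ^ (k + 1) * w l = (1 + η) * δ * (((1 + η) * δ) ^ k * w l) := by ring
        _ ≤ (1 + η) * δ * ∑ i, w i * N k i l :=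
          mul_le_mul_of_nonneg_left (ih l) (by positivity)
        _ = ∑ i, ((1 + η) * δ * w i) * N k i l := by
          rw [Finset.mul_sum]; simp only [mul_assoc]
        _ ≤ ∑ i, (∑ i', w i' * S i' i) * N k i l :=
          Finset.sum_le_sum fun i _ => mul_le_mul_of_nonneg_right (hstep i) (hNnn k i l)
        _ = ∑ i, w i * N (k + 1) i l := by
          simp only [hN, Finset.sum_mul, Finset.mul_sum, mul_assoc]
          exact Finset.sum_comm
  have hbd : ∀ k, (1 + η) ^ k ≤ s * C / w j := by
    intro k
    rw [le_div_iff₀ hwj]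
    have h1 : ∑ i, w i * N k i j ≤ s * (C * δ ^ k) := by
      rw [hs, Finset.sum_mul]
      exact Finset.sum_le_sum fun i _ => mul_le_mul_of_nonneg_left (hC k i j) (hw0 i)
    have h2 := (hgrow k j).trans h1
    rw [mul_pow] at h2
    have : 0 < δ ^ k := pow_pos hδ k
    nlinarith
  obtain ⟨k, hk⟩ := pow_unbounded_of_one_lt (s * C / w j) (show 1 < 1 + η by linarith)
  exact absurd (hbd k) (not_le.2 hk)

/-- If the measure of a finite union is the sum of the measures, then the sets overlap in null
sets. -/
theorem measure_inter_eq_zero_of_sum_le {α ι : Type*} [MeasurableSpace α] {μ : Measure α}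
    {s : Finset ι} {X : ι → Set α} (hX : ∀ i ∈ s, MeasurableSet (X i))
    (hfin : ∀ i ∈ s, μ (X i) ≠ ∞) (hle : ∑ i ∈ s, μ (X i) ≤ μ (⋃ i ∈ s, X i))
    {i j : ι} (hi : i ∈ s) (hj : j ∈ s) (hij : i ≠ j) : μ (X i ∩ X j) = 0 := by
  classical
  have hsub : (⋃ l ∈ s, X l) ⊆ (⋃ l ∈ s.erase i, X l) ∪ (X i \ X j) := by
    intro y hy
    simp only [Set.mem_iUnion, Finset.mem_erase, Set.mem_union, Set.mem_sdiff] at hy ⊢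
    obtain ⟨l, hl, hyl⟩ := hy
    by_cases hyj : y ∈ X j
    · exact Or.inl ⟨j, ⟨hij.symm, hj⟩, hyj⟩
    · by_cases hli : l = i
      · exact Or.inr ⟨hli ▸ hyl, hyj⟩
      · exact Or.inl ⟨l, ⟨hli, hl⟩, hyl⟩
  have h1 : ∑ l ∈ s, μ (X l) ≤ ∑ l ∈ s.erase i, μ (X l) + μ (X i \ X j) :=
    hle.trans ((measure_mono hsub).trans ((measure_union_le _ _).trans
      (add_le_add_left (measure_biUnion_finset_le _ _) _)))
  rw [← Finset.sum_erase_add _ _ hi, ← measure_inter_add_sdiff (X i) (hX j hj)] at h1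
  have hf1 : ∑ l ∈ s.erase i, μ (X l) ≠ ∞ :=
    ENNReal.sum_ne_top.2 fun l hl => hfin l (Finset.mem_of_mem_erase hl)
  have hf2 : μ (X i \ X j) ≠ ∞ := measure_ne_top_of_subset Set.sdiff_subset (hfin i hi)
  have h2 := (ENNReal.add_le_add_iff_left hf1).1 h1
  have h3 : μ (X i ∩ X j) + μ (X i \ X j) ≤ 0 + μ (X i \ X j) := by rwa [zero_add]
  exact le_antisymm ((ENNReal.add_le_add_iff_right hf2).1 h3) zero_le

section Tiles

variable {d m : ℕ} {Λ : MultiColourSet d m} {Q : Euc d →ₗ[ℝ] Euc d}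
  {D : Fin m → Fin m → Finset (Euc d)} {A : Fin m → Set (Euc d)} {κ : ℝ}

/-- The tiles are the intersections of the decreasing compact sets `tileApprox`. They decrease
because digits have norm at most κ and Q doubles lengths. Each stage covers space together with Λ,
the covering at Q p being pulled back to p through the parent of a point. -/
theorem IsStrongSubstitution.exists_tileSystem (h : IsStrongSubstitution Λ Q D) :
    ∃ A κ, IsTileSystem Λ Q D A κ := by
  obtain ⟨κ₁, hκ₁, hD, hdig⟩ := h.exists_dig_bound
  obtain ⟨R, hR0, hR⟩ := h.dense
  set κ := max κ₁ R with hκ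
  have hcont : Continuous Q := LinearMap.continuous_of_finiteDimensional Q
  have hanti : ∀ k j, tileApprox Q D κ (k + 1) j ⊆ tileApprox Q D κ k j := by
    intro k
    induction k with
    | zero =>
      rintro j y ⟨i, b, hb, hy⟩
      simp only [tileApprox, Metric.mem_closedBall, dist_zero_right] at hy ⊢
      have h1 := norm_add_le (Q y - b) b
      rw [sub_add_cancel] at h1
      linarith [h.expand y, (hD i j b hb).trans (le_max_left κ₁ R)]
    | succ k ih =>
      rintro j y ⟨i, b, hb, hy⟩
      exact ⟨i, b, hb, ih i hy⟩
  have hanti' : ∀ j, Antitone fun k => tileApprox Q D κ k j := fun j =>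
    antitone_nat_of_succ_le fun k => hanti k j
  have hclosed : ∀ k j, IsClosed (tileApprox Q D κ k j) := by
    intro k
    induction k with
    | zero => exact fun j => Metric.isClosed_closedBall
    | succ k ih =>
      intro j
      have : tileApprox Q D κ (k + 1) j =
          ⋃ i, ⋃ b ∈ D i j, (fun y => Q y - b) ⁻¹' tileApprox Q D κ k i := by
        ext y
        simp [tileApprox]
      rw [this]
      refine isClosed_iUnion_of_finite fun i => ?_
      exact (D i j).finite_toSet.isClosed_biUnion fun b _ =>
        (ih i).preimage (hcont.sub continuous_const)
  have hcover : ∀ k p, ∃ j, ∃ u ∈ Λ j, p - u ∈ tileApprox Q D κ k j := by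
    intro k
    induction k with
    | zero =>
      intro p
      obtain ⟨i₀, -⟩ := h.good
      obtain ⟨u, hu, hup⟩ := hR i₀ p
      refine ⟨i₀, u, hu, ?_⟩
      simp only [tileApprox, Metric.mem_closedBall, dist_zero_right]
      rw [norm_sub_rev]
      exact hup.trans (le_max_right _ _)
    | succ k ih =>
      intro p
      obtain ⟨i, v, hv, hpv⟩ := ih (Q p)
      rw [← h.fixed, mem_mfs] at hv
      obtain ⟨j, u, hu, b, hb, rfl⟩ := hv
      refine ⟨j, u, hu, i, b, hb, ?_⟩
      rwa [map_sub, sub_sub]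
  refine ⟨fun j => ⋂ k, tileApprox Q D κ k j, κ, fun j => isClosed_iInter fun k => hclosed k j,
    ?_, ?_, ?_, lt_max_of_lt_left hκ₁, ?_⟩
  · intro j y hy
    simpa [tileApprox] using Set.mem_iInter.1 hy 0
  · intro j y
    constructor
    · intro hy
      have hfin : (Set.univ ×ˢ ⋃ i, (D i j : Set (Euc d))).Finite :=
        Set.Finite.prod (Set.finite_univ (α := Fin m))
          (Set.finite_iUnion fun i => (D i j).finite_toSet)
      obtain ⟨⟨i, b⟩, -, hib⟩ := exists_forall_of_antitone hfin
        (P := fun k ib => ib.2 ∈ D ib.1 j ∧ Q y - ib.2 ∈ tileApprox Q D κ k ib.1)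
        (fun k l ib hkl hib => ⟨hib.1, hanti' _ hkl hib.2⟩) (fun k => by
          obtain ⟨i, b, hb, hy⟩ := Set.mem_iInter.1 hy (k + 1)
          exact ⟨(i, b), ⟨Set.mem_univ _, Set.mem_iUnion.2 ⟨i, hb⟩⟩, hb, hy⟩)
      exact ⟨i, b, (hib 0).1, Set.mem_iInter.2 fun k => (hib k).2⟩
    · rintro ⟨i, b, hb, hy⟩
      refine Set.mem_iInter.2 fun k => hanti k j ?_
      exact ⟨i, b, hb, Set.mem_iInter.1 hy k⟩
  · intro p
    have hfin : (Set.univ ×ˢ ⋃ i, (Λ i ∩ Metric.closedBall p κ)).Finite :=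
      Set.Finite.prod (Set.finite_univ (α := Fin m))
        (Set.finite_iUnion fun i => h.finite_inter_closedBall i p κ)
    obtain ⟨⟨i, u⟩, -, hiu⟩ := exists_forall_of_antitone hfin
      (P := fun k iu => iu.2 ∈ Λ iu.1 ∧ p - iu.2 ∈ tileApprox Q D κ k iu.1)
      (fun k l iu hkl hiu => ⟨hiu.1, hanti' _ hkl hiu.2⟩) (fun k => by
        obtain ⟨i, u, hu, hpu⟩ := hcover k p
        refine ⟨(i, u), ⟨Set.mem_univ _, Set.mem_iUnion.2 ⟨i, hu, ?_⟩⟩, hu, hpu⟩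
        have := hanti' i (Nat.zero_le k) hpu
        simpa [tileApprox, dist_eq_norm, norm_sub_rev] using this)
    exact ⟨i, u, (hiu 0).1, Set.mem_iInter.2 fun k => (hiu k).2⟩
  · intro k i j a ha
    obtain ⟨b, hb, hbn⟩ := hdig k i j a ha
    exact ⟨b, hb, hbn.trans (le_max_left _ _)⟩

namespace IsTileSystem

theorem volume_ne_top (hA : IsTileSystem Λ Q D A κ) (j : Fin m) : volume (A j) ≠ ∞ :=
  ((measure_mono fun y hy => mem_closedBall_zero_iff.2 (hA.bound j y hy)).trans_lt
    measure_closedBall_lt_top).ne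

theorem volume_preimage_sub (j : Fin m) (u : Euc d) :
    volume {y | y - u ∈ A j} = volume (A j) := by
  simpa only [Set.preimage, sub_eq_add_neg] using measure_preimage_add_right volume (-u) (A j)

theorem measurableSet_sub (hA : IsTileSystem Λ Q D A κ) (j : Fin m) (u : Euc d) :
    MeasurableSet {y | y - u ∈ A j} :=
  (hA.closed j).measurableSet.preimage (measurable_sub_const u)

end IsTileSystem

theorem IsStrongSubstitution.det_pos (h : IsStrongSubstitution Λ Q D) :
    0 < |LinearMap.det Q| := by
  rw [abs_pos]
  have hu : IsUnit Q := (Module.End.isUnit_iff Q).2 ⟨h.injective, h.surjective⟩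
  exact (hu.map LinearMap.det).ne_zero

theorem volume_image_pow (Q : Euc d →ₗ[ℝ] Euc d) (k : ℕ) (s : Set (Euc d)) :
    volume ((Q ^ k) '' s) = ENNReal.ofReal (|LinearMap.det Q| ^ k) * volume s := by
  rw [Measure.addHaar_image_linearMap, map_pow, abs_pow]

/-- Q A_j contains a translate of every A_i, so one null tile would make all tiles null, although
countably many translates cover space. -/
theorem IsTileSystem.volume_pos (hA : IsTileSystem Λ Q D A κ) (h : IsStrongSubstitution Λ Q D)
    (j : Fin m) : 0 < volume (A j) := by
  have hsub : ∀ i, volume (A i) ≤ ENNReal.ofReal (|LinearMap.det Q| ^ 1) * volume (A j) := by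
    intro i
    obtain ⟨b, hb⟩ := h.nonempty i j
    rw [← volume_image_pow, ← IsTileSystem.volume_preimage_sub i b]
    refine measure_mono fun y hy => ?_
    obtain ⟨x, rfl⟩ := h.pow_surjective 1 y
    exact ⟨x, (hA.mem_iff j x).2 ⟨i, b, hb, by simpa using hy⟩, rfl⟩
  rw [pos_iff_ne_zero]
  intro h0
  have hz : ∀ i, volume (A i) = 0 := fun i => by simpa [h0] using hsub i
  have hnull : volume (⋃ i, ⋃ u ∈ Λ i, {y | y - u ∈ A i}) = 0 := by
    refine measure_iUnion_null fun i => (measure_biUnion_null_iff (h.countable_set i)).2 ?_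
    intro u _
    rw [IsTileSystem.volume_preimage_sub, hz]
  have huniv : (⋃ i, ⋃ u ∈ Λ i, {y | y - u ∈ A i}) = Set.univ := by
    refine Set.eq_univ_of_forall fun p => ?_
    obtain ⟨i, u, hu, hp⟩ := hA.cover p
    simp only [Set.mem_iUnion]
    exact ⟨i, u, hu, hp⟩
  rw [huniv] at hnull
  exact (NeZero.ne (volume : Measure (Euc d))) (Measure.measure_univ_eq_zero.1 hnull)

/-- Packing: applied to one point of Λ_j, the digits of level k give separated points in the image
under Q^k of a fixed ball. -/
theorem IsTileSystem.card_dig_le (hA : IsTileSystem Λ Q D A κ) (h : IsStrongSubstitution Λ Q D) :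
    ∃ C : ℝ, ∀ k i j, ((dig Q D k i j).card : ℝ) ≤ C * |LinearMap.det Q| ^ k := by
  obtain ⟨r, hr, hsep⟩ := h.separated
  set v := volume.real (Metric.ball (0 : Euc d) (r / 2)) with hv
  have hv0 : 0 < v := ENNReal.toReal_pos (Metric.measure_ball_pos _ _ (by linarith)).ne'
    measure_ball_lt_top.ne
  refine ⟨volume.real (Metric.closedBall (0 : Euc d) (κ + r / 2)) / v, fun k i j => ?_⟩
  obtain ⟨x, hx⟩ := h.set_nonempty j
  set T : Euc d → Set (Euc d) := fun a => Metric.ball ((Q ^ k) x + a) (r / 2) with hT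
  have hdisj : Set.PairwiseDisjoint (dig Q D k i j : Set (Euc d)) T := by
    intro a ha b hb hab
    refine Metric.ball_disjoint_ball ?_
    rw [add_halves]
    exact hsep i _ (h.mem_of_dig hx ha) _ (h.mem_of_dig hx hb) (by simpa using hab)
  have hsub : (⋃ a ∈ dig Q D k i j, T a) ⊆ (Q ^ k) '' Metric.closedBall x (κ + r / 2) := by
    simp only [Set.iUnion_subset_iff]
    intro a ha p hp
    obtain ⟨b, rfl, hb⟩ := hA.dig_bound k i j a ha
    obtain ⟨p, rfl⟩ := h.pow_surjective k p
    refine ⟨p, ?_, rfl⟩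
    rw [Metric.mem_closedBall, dist_eq_norm]
    simp only [hT, Metric.mem_ball, dist_eq_norm, ← map_add, ← map_sub] at hp
    have h1 := (h.norm_le_norm_pow k _).trans hp.le
    have h2 : p - x = (p - (x + b)) + b := by abel
    rw [h2]
    linarith [norm_add_le (p - (x + b)) b]
  have hle := measure_mono (μ := volume) hsub
  rw [measure_biUnion_finset hdisj fun _ _ => measurableSet_ball, volume_image_pow] at hle
  simp only [hT, Measure.addHaar_ball_center, Measure.addHaar_closedBall_center] at hle
  rw [Finset.sum_const, nsmul_eq_mul] at hle
  have hle' := ENNReal.toReal_mono (ENNReal.mul_ne_top ENNReal.ofReal_ne_top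
    measure_closedBall_lt_top.ne) hle
  rw [ENNReal.toReal_mul, ENNReal.toReal_mul, ENNReal.toReal_natCast,
    ENNReal.toReal_ofReal (by positivity)] at hle'
  rw [div_mul_eq_mul_div, le_div_iff₀ hv0]
  calc _ ≤ _ := hle'
    _ = _ := mul_comm _ _

theorem IsTileSystem.image_eq (hA : IsTileSystem Λ Q D A κ) (h : IsStrongSubstitution Λ Q D)
    (j : Fin m) : Q '' A j =
      ⋃ p ∈ Finset.univ.sigma fun i => D i j, {y | y - p.2 ∈ A p.1} := by
  ext y
  simp only [Set.mem_image, Set.mem_iUnion, Finset.mem_sigma, Finset.mem_univ, true_and,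
    Sigma.exists, exists_prop]
  constructor
  · rintro ⟨x, hx, rfl⟩
    obtain ⟨i, b, hb, hy⟩ := (hA.mem_iff j x).1 hx
    exact ⟨i, b, hb, hy⟩
  · rintro ⟨i, b, hb, hy⟩
    obtain ⟨x, rfl⟩ := h.surjective y
    exact ⟨x, (hA.mem_iff j x).2 ⟨i, b, hb, hy⟩, rfl⟩

/-- The volumes of the tiles form a left eigenvector of the substitution matrix. -/
theorem IsTileSystem.sum_volume (hA : IsTileSystem Λ Q D A κ) (h : IsStrongSubstitution Λ Q D)
    (j : Fin m) :
    ∑ i, volume.real (A i) * (D i j).card = |LinearMap.det Q| * volume.real (A j) := by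
  obtain ⟨C, hC⟩ := hA.card_dig_le h
  refine eq_of_subinvariant (fun i j => ((D i j).card : ℝ)) (fun k i j => (dig Q D k i j).card)
    _ _ C h.det_pos ?_ ?_ ?_ hC (fun i => measureReal_nonneg) ?_ j
  · intro i j
    exact_mod_cast Finset.card_pos.2 (h.nonempty i j)
  · intro i j
    by_cases hij : i = j <;> simp [dig, hij]
  · intro k i j
    exact_mod_cast card_dig_succ h.unique h.injective h.fixed k i j (h.set_nonempty j)
  · intro j
    -- Subadditivity gives one inequality; `eq_of_subinvariant` makes it an equality.
    have h1 : volume (Q '' A j) ≤ ∑ i, volume (A i) * (D i j).card := by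
      rw [hA.image_eq h]
      refine (measure_biUnion_finset_le _ _).trans (le_of_eq ?_)
      rw [Finset.sum_sigma]
      refine Finset.sum_congr rfl fun i _ => ?_
      simp only [IsTileSystem.volume_preimage_sub, Finset.sum_const, nsmul_eq_mul]
      exact mul_comm _ _
    rw [Measure.addHaar_image_linearMap] at h1
    have h2 := ENNReal.toReal_mono (ENNReal.sum_ne_top.2 fun i _ =>
      ENNReal.mul_ne_top (hA.volume_ne_top i) (ENNReal.natCast_ne_top _)) h1
    rw [ENNReal.toReal_mul, ENNReal.toReal_ofReal (abs_nonneg _), ENNReal.toReal_sum fun i _ =>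
      ENNReal.mul_ne_top (hA.volume_ne_top i) (ENNReal.natCast_ne_top _)] at h2
    simpa [ENNReal.toReal_mul, Measure.real] using h2

/-- By `sum_volume` the volumes of the pieces of Q A_j add up to the volume of their union, which
leaves no room for overlaps. -/
theorem IsTileSystem.null_inter_digit (hA : IsTileSystem Λ Q D A κ)
    (h : IsStrongSubstitution Λ Q D) {i i' j : Fin m} {a a' : Euc d} (ha : a ∈ D i j)
    (ha' : a' ∈ D i' j) (hne : (i, a) ≠ (i', a')) :
    volume {y | y - a ∈ A i ∧ y - a' ∈ A i'} = 0 := by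
  refine measure_inter_eq_zero_of_sum_le (μ := volume)
    (s := Finset.univ.sigma fun i => D i j)
    (X := fun p : (_ : Fin m) × Euc d => {y | y - p.2 ∈ A p.1}) (i := ⟨i, a⟩) (j := ⟨i', a'⟩)
    (fun p _ => hA.measurableSet_sub _ _) (fun p _ => ?_) ?_ (by simpa using ha)
    (by simpa using ha') ?_
  · rw [IsTileSystem.volume_preimage_sub]
    exact hA.volume_ne_top _
  · rw [← hA.image_eq h, Measure.addHaar_image_linearMap, Finset.sum_sigma]
    simp only [IsTileSystem.volume_preimage_sub, Finset.sum_const, nsmul_eq_mul]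
    have h1 := congrArg ENNReal.ofReal (hA.sum_volume h j)
    rw [ENNReal.ofReal_mul (abs_nonneg _), ENNReal.ofReal_sum_of_nonneg
      fun i _ => by positivity] at h1
    simp only [ENNReal.ofReal_mul measureReal_nonneg, ENNReal.ofReal_natCast,
      ofReal_measureReal (hA.volume_ne_top _)] at h1
    rw [← h1]
    exact le_of_eq (Finset.sum_congr rfl fun i _ => mul_comm _ _)
  · intro heq
    simp only [Sigma.mk.injEq, heq_eq_eq] at heq
    exact hne (Prod.ext heq.1 heq.2)

theorem IsTileSystem.map_mem_of_dig (hA : IsTileSystem Λ Q D A κ) {k : ℕ} {i j : Fin m}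
    {a y : Euc d} (ha : a ∈ dig Q D k i j) (hy : (Q ^ k) y - a ∈ A i) : y ∈ A j := by
  induction k generalizing i a y with
  | zero =>
    obtain ⟨rfl, rfl⟩ := mem_dig_zero.1 ha
    simpa using hy
  | succ k ih =>
    obtain ⟨l, b, hb, e, he, rfl⟩ := mem_dig_succ.1 ha
    refine ih he ((hA.mem_iff l _).2 ⟨i, b, hb, ?_⟩)
    rw [pow_succ', Module.End.mul_apply] at hy
    rwa [map_sub, sub_sub, add_comm]

/-- Two subtiles of a supertile of level k + 1 lie in the same supertile of level k, where induction
applies, or in two supertiles Q^k(A_l + b) and Q^k(A_l' + b') that overlap in a null set. -/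
theorem IsTileSystem.null_inter_dig (hA : IsTileSystem Λ Q D A κ)
    (h : IsStrongSubstitution Λ Q D) (k : ℕ) {i i' j : Fin m} {a a' : Euc d}
    (ha : a ∈ dig Q D k i j) (ha' : a' ∈ dig Q D k i' j) (hne : (i, a) ≠ (i', a')) :
    volume {y | y - a ∈ A i ∧ y - a' ∈ A i'} = 0 := by
  induction k generalizing j a a' with
  | zero =>
    obtain ⟨rfl, rfl⟩ := mem_dig_zero.1 ha
    obtain ⟨rfl, rfl⟩ := mem_dig_zero.1 ha'
    exact absurd rfl hne
  | succ k ih =>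
    obtain ⟨l, e, he, b, hb, rfl⟩ := mem_dig_add.1 ha
    obtain ⟨l', e', he', b', hb', rfl⟩ := mem_dig_add.1 ha'
    rw [dig_one] at hb hb'
    by_cases hlb : (l, b) = (l', b')
    · obtain ⟨rfl, rfl⟩ := Prod.ext_iff.1 hlb
      have := ih he he' (fun heq => hne (by
        obtain ⟨h1, h2⟩ := Prod.ext_iff.1 heq
        simp only at h1 h2
        rw [h1, h2]))
      rw [← measure_preimage_add_right volume (-(Q ^ k) b)] at this
      refine measure_mono_null (fun y hy => ?_) this
      simpa only [Set.mem_preimage, Set.mem_ofPred_eq, ← sub_eq_add_neg, sub_sub,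
        add_comm ((Q ^ k) b)] using hy
    · have := hA.null_inter_digit h hb hb' hlb
      have himg : volume ((Q ^ k) '' {y | y - b ∈ A l ∧ y - b' ∈ A l'}) = 0 := by
        rw [volume_image_pow, this, mul_zero]
      refine measure_mono_null (fun y hy => ?_) himg
      obtain ⟨x, rfl⟩ := h.pow_surjective k y
      refine ⟨x, ⟨hA.map_mem_of_dig he ?_, hA.map_mem_of_dig he' ?_⟩, rfl⟩
      · rw [map_sub, sub_sub, add_comm]
        exact hy.1
      · rw [map_sub, sub_sub, add_comm]
        exact hy.2

/-- By legality, two points of Λ occur together, up to translation, among the digits of one level.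
-/
theorem IsTileSystem.null_inter (hA : IsTileSystem Λ Q D A κ)
    (h : IsStrongSubstitution Λ Q D) {i i' : Fin m} {u u' : Euc d} (hu : u ∈ Λ i)
    (hu' : u' ∈ Λ i') (hne : (i, u) ≠ (i', u')) :
    volume {y | y - u ∈ A i ∧ y - u' ∈ A i'} = 0 := by
  classical
  obtain ⟨k, hk⟩ := h.legal
    (fun l => (if l = i then {u} else ∅) ∪ (if l = i' then {u'} else ∅)) (fun l => by
      intro p hp
      simp only [Finset.coe_union, Set.mem_union, Finset.mem_coe] at hp
      rcases hp with hp | hp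
      · split_ifs at hp with hl
        · rw [Finset.mem_singleton] at hp
          rwa [hp, hl]
        · simp at hp
      · split_ifs at hp with hl
        · rw [Finset.mem_singleton] at hp
          rwa [hp, hl]
        · simp at hp)
  obtain ⟨a, ha⟩ := hk i
  have := hA.null_inter_dig h k (ha i u (by simp)) (ha i' u' (by simp)) (fun heq => hne (by
    obtain ⟨h1, h2⟩ := Prod.ext_iff.1 heq
    exact Prod.ext h1 (add_left_cancel h2)))
  rw [← measure_preimage_add_right volume a] at this
  refine measure_mono_null (fun y hy => ?_) this
  simp only [Set.mem_preimage, Set.mem_ofPred_eq, add_sub_add_right_eq_sub, add_comm a]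
  exact hy

/-- A translate inside `Λ` of all points of `Λ` in a ball leaves no room for other points. -/
theorem IsTileSystem.mem_of_translate (hA : IsTileSystem Λ Q D A κ)
    (h : IsStrongSubstitution Λ Q D) {a c : Euc d} {R : ℝ}
    (hsub : ∀ i, ∀ p ∈ Λ i, ‖p - c‖ ≤ R + 2 * κ → p + a ∈ Λ i) {i : Fin m} {s : Euc d}
    (hs : s ∈ Λ i) (hsc : ‖s - (c + a)‖ ≤ R) : s - a ∈ Λ i := by
  by_contra hsa
  -- The tile at s is covered by tiles at points v + a with v ∈ Λ; such v lie within R + 2κ of c, so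
  -- v + a ∈ Λ. If s - a ∉ Λ_i, none of these is the tile at s itself, and a set of positive volume
  -- is covered by countably many null overlaps.
  have hnull : volume (⋃ j, ⋃ v ∈ {v | v ∈ Λ j ∧ (i, s) ≠ (j, v)},
      {y | y - s ∈ A i ∧ y - v ∈ A j}) = 0 := by
    refine measure_iUnion_null fun j => (measure_biUnion_null_iff
      ((h.countable_set j).mono fun v hv => hv.1)).2 ?_
    exact fun v hv => hA.null_inter h hs hv.1 hv.2
  have hle : {y | y - s ∈ A i} ⊆ ⋃ j, ⋃ v ∈ {v | v ∈ Λ j ∧ (i, s) ≠ (j, v)},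
      {y | y - s ∈ A i ∧ y - v ∈ A j} := by
    intro y hy
    have hy : y - s ∈ A i := hy
    obtain ⟨j, v, hv, hyv⟩ := hA.cover (y - a)
    have h1 : v + a ∈ Λ j := by
      refine hsub j v hv ?_
      have : v - c = -(y - a - v) + (y - s) + (s - (c + a)) := by abel
      rw [this]
      have h1 := norm_add₃_le (a := -(y - a - v)) (b := y - s) (c := s - (c + a))
      rw [norm_neg] at h1
      linarith [hA.bound _ _ hyv, hA.bound _ _ hy]
    simp only [Set.mem_iUnion]
    refine ⟨j, v + a, ⟨h1, fun heq => hsa ?_⟩, hy, ?_⟩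
    · obtain ⟨h2, h3⟩ := Prod.ext_iff.1 heq
      simp only at h2 h3
      rw [h3, add_sub_cancel_right, h2]
      exact hv
    · rwa [add_comm, ← sub_sub]
  have h0 := measure_mono_null hle hnull
  rw [IsTileSystem.volume_preimage_sub] at h0
  exact (hA.volume_pos h i).ne' h0

end Tiles

/-! ### Agreement of translates, repetitivity -/

/-- The translates `x + Λ` and `y + Λ` agree on the image under `Q ^ k` of the ball with centre `c`
and radius `R`. -/
def AgreeOn {d m : ℕ} (Λ : MultiColourSet d m) (Q : Euc d →ₗ[ℝ] Euc d) (k : ℕ)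
    (x y c : Euc d) (R : ℝ) : Prop :=
  ∀ i s, ‖s - c‖ ≤ R → ((Q ^ k) s - x ∈ Λ i ↔ (Q ^ k) s - y ∈ Λ i)

/-- The points of `Λ` at distance at most `R` from `u`, relative to `u`. -/
def patch {d m : ℕ} (Λ : MultiColourSet d m) (R : ℝ) (u : Euc d) : MultiColourSet d m :=
  fun i => {v | ‖v‖ ≤ R ∧ u + v ∈ Λ i}

section Repetitivity

variable {d m : ℕ} {Λ : MultiColourSet d m} {Q : Euc d →ₗ[ℝ] Euc d}
  {D : Fin m → Fin m → Finset (Euc d)} {A : Fin m → Set (Euc d)} {κ : ℝ}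

namespace AgreeOn

variable {k : ℕ} {x y z c : Euc d} {R : ℝ}

theorem symm (h : AgreeOn Λ Q k x y c R) : AgreeOn Λ Q k y x c R :=
  fun i s hs => (h i s hs).symm

theorem trans (h : AgreeOn Λ Q k x y c R) (h' : AgreeOn Λ Q k y z c R) :
    AgreeOn Λ Q k x z c R :=
  fun i s hs => (h i s hs).trans (h' i s hs)

theorem mono (h : AgreeOn Λ Q k x y c R) {c' : Euc d} {R' : ℝ} (hR : ‖c' - c‖ + R' ≤ R) :
    AgreeOn Λ Q k x y c' R' := by
  intro i s hs
  refine h i s ?_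
  have : s - c = (s - c') + (c' - c) := by abel
  rw [this]
  linarith [norm_add_le (s - c') (c' - c)]

theorem translate (h : AgreeOn Λ Q k x y c R) (t : Euc d) :
    AgreeOn Λ Q k (x + (Q ^ k) t) (y + (Q ^ k) t) (c + t) R := by
  intro i s hs
  have := h i (s - t) (by rwa [sub_sub, add_comm t])
  rwa [map_sub, sub_sub, sub_sub, add_comm _ x, add_comm _ y] at this

/-- An ancestor n levels up is displaced, before inflation, by a vector b with ‖b‖ ≤ κ. The loss in
radius is therefore κ for every n. -/
theorem inflate (h : IsStrongSubstitution Λ Q D) (hA : IsTileSystem Λ Q D A κ)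
    (hag : AgreeOn Λ Q 0 x y c (R + κ)) (n : ℕ) :
    AgreeOn Λ Q n ((Q ^ n) x) ((Q ^ n) y) c R := by
  have key : ∀ x y, AgreeOn Λ Q 0 x y c (R + κ) → ∀ i s, ‖s - c‖ ≤ R →
      (Q ^ n) s - (Q ^ n) x ∈ Λ i → (Q ^ n) s - (Q ^ n) y ∈ Λ i := by
    intro x y hag i s hs hmem
    obtain ⟨j, u, hu, a, ha, heq⟩ := (mem_iff_exists_dig h.fixed n).1 hmem
    obtain ⟨b, rfl, hb⟩ := hA.dig_bound n i j a ha
    rw [← map_sub, ← map_add] at heq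
    have hux : u = s - b - x := by
      rw [sub_right_comm, h.pow_injective n heq, add_sub_cancel_right]
    have h1 := (hag j (s - b) (by
      rw [sub_right_comm]
      exact (norm_sub_le _ _).trans (add_le_add hs hb))).1
    simp only [pow_zero, Module.End.one_apply] at h1
    have h2 := h.mem_of_dig (h1 (hux ▸ hu)) ha
    rw [← map_add] at h2
    rwa [← map_sub, show s - y = s - b - y + b by abel]
  exact fun i s hs => ⟨key x y hag i s hs, key y x hag.symm i s hs⟩

end AgreeOn

namespace IsStrongSubstitution

/-- Finite local complexity. For fixed x ∈ Λ_i and y ∈ Λ_j, v - (x - y) is a sum of two elements of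
Ξ, so the coincidence puts ξ + Q²(v - (x - y)) into Λ_{i₀}, within a bounded region. -/
theorem finite_differences (h : IsStrongSubstitution Λ Q D) (i j : Fin m) (R : ℝ) :
    {v : Euc d | ‖v‖ ≤ R ∧ ∃ u ∈ Λ j, u + v ∈ Λ i}.Finite := by
  obtain ⟨i₀, ξ, hξ, hg⟩ := h.exists_coincidence
  obtain ⟨x, hx⟩ := h.set_nonempty i
  obtain ⟨y, hy⟩ := h.set_nonempty j
  obtain ⟨C, hC1, hC⟩ := exists_norm_pow_le Q 2
  have hinj : Function.Injective fun v => ξ + (Q ^ 2) (v - (x - y)) := fun v w hvw =>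
    sub_left_injective (h.pow_injective 2 (add_left_cancel hvw))
  refine Set.Finite.of_finite_image ?_ hinj.injOn
  refine (h.finite_inter_closedBall i₀ ξ (C * (R + ‖x - y‖))).subset ?_
  rintro _ ⟨v, ⟨hv, u, hu, huv⟩, rfl⟩
  constructor
  · have h1 := hg _ (h.map_add_mem_Xi (sub_mem_Xi huv hx) (sub_mem_Xi hy hu))
    rwa [show u + v - x + (y - u) = v - (x - y) by abel] at h1
  · rw [Metric.mem_closedBall, dist_eq_norm, add_sub_cancel_left]
    refine (hC _).trans (mul_le_mul_of_nonneg_left ?_ (by linarith))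
    exact (norm_sub_le _ _).trans (by linarith)

theorem finite_patches (h : IsStrongSubstitution Λ Q D) (j : Fin m) (R : ℝ) :
    (patch Λ R '' Λ j).Finite := by
  have hfin : (Set.univ.pi fun i => 𝒫 {v : Euc d | ‖v‖ ≤ R ∧ ∃ u ∈ Λ j, u + v ∈ Λ i}).Finite :=
    Set.Finite.pi fun i => (h.finite_differences i j R).finite_subsets
  refine hfin.subset ?_
  rintro _ ⟨u, hu, rfl⟩ i - v ⟨hv, huv⟩
  exact ⟨hv, u, hu, huv⟩

/-- Repetitivity. -/
theorem exists_return (h : IsStrongSubstitution Λ Q D) (j₀ : Fin m) (R : ℝ) :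
    ∃ R' : ℝ, ∀ u ∈ Λ j₀, ∀ w, ∃ t, u + t ∈ Λ j₀ ∧ AgreeOn Λ Q 0 t 0 (u + t) R ∧
      ‖u + t - w‖ ≤ R' := by
  classical
  obtain ⟨A, κ, hA⟩ := h.exists_tileSystem
  obtain ⟨R₀, hR₀, hdense⟩ := h.dense
  -- `mem_of_translate` consumes the margin 2κ; the maximum with 0 keeps the centre in its own
  -- patch.
  set R₁ := max (R + 2 * κ) 0 with hR₁
  obtain ⟨U, hUsub, hU⟩ : ∃ U : Finset (Euc d), (U : Set (Euc d)) ⊆ Λ j₀ ∧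
      ∀ u ∈ Λ j₀, ∃ u' ∈ U, patch Λ R₁ u = patch Λ R₁ u' := by
    obtain ⟨U, hU, himg⟩ := Set.exists_subset_bijOn (Λ j₀) (patch Λ R₁)
    have hfinU : U.Finite := Set.Finite.of_finite_image
      (himg.image_eq ▸ h.finite_patches j₀ R₁) himg.injOn
    refine ⟨hfinU.toFinset, by simpa using hU, fun u hu => ?_⟩
    obtain ⟨u', hu', heq⟩ := himg.surjOn ⟨u, hu, rfl⟩
    exact ⟨u', by simpa using hu', heq.symm⟩
  -- One cluster that contains every patch type of radius R₁ around points of colour j₀. It occurs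
  -- in every supertile of one level k, and the supertiles of colour j₀ have bounded gaps.
  set P : Fin m → Finset (Euc d) := fun i =>
    U.biUnion fun u => (h.finite_inter_closedBall i u R₁).toFinset with hP
  obtain ⟨k, hk⟩ := h.legal P (fun i p hp => by
    simp only [hP, Finset.coe_biUnion, Set.mem_iUnion, Set.Finite.coe_toFinset] at hp
    obtain ⟨u, -, hp⟩ := hp
    exact hp.1)
  obtain ⟨a, ha⟩ := hk j₀
  obtain ⟨C, hC1, hC⟩ := exists_norm_pow_le Q k
  refine ⟨∑ u ∈ U, ‖u‖ + ‖a‖ + C * R₀, fun u hu w => ?_⟩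
  obtain ⟨u', hu', hpatch⟩ := hU u hu
  obtain ⟨w, rfl⟩ := h.pow_surjective k w
  obtain ⟨x, hx, hxw⟩ := hdense j₀ w
  have hmemP : ∀ i v, ‖v‖ ≤ R₁ → u' + v ∈ Λ i → u' + v ∈ P i := by
    intro i v hv hmem
    simp only [hP, Finset.mem_biUnion, Set.Finite.mem_toFinset]
    exact ⟨u', hu', hmem, by simpa [dist_eq_norm] using hv⟩
  have hin : ∀ i, ∀ p ∈ P i, p + ((Q ^ k) x + a) ∈ Λ i := fun i p hp => by
    have := h.mem_of_dig hx (ha i p hp)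
    rwa [← add_assoc, add_comm] at this
  have hut : u + ((Q ^ k) x + a + u' - u) = u' + ((Q ^ k) x + a) := by abel
  refine ⟨(Q ^ k) x + a + u' - u, ?_, ?_, ?_⟩
  · rw [hut]
    refine hin j₀ u' ?_
    simpa using hmemP j₀ 0 (by simp [hR₁]) (by simpa using hUsub hu')
  · intro i s hs
    have hsub : ∀ i, ∀ p ∈ Λ i, ‖p - u‖ ≤ R + 2 * κ →
        p + ((Q ^ k) x + a + u' - u) ∈ Λ i := by
      intro i p hp hpu
      have h1 : p - u ∈ patch Λ R₁ u i := ⟨hpu.trans (le_max_left _ _), by simpa using hp⟩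
      rw [hpatch] at h1
      have h2 := hin i _ (hmemP i _ h1.1 h1.2)
      rwa [show p + ((Q ^ k) x + a + u' - u) = u' + (p - u) + ((Q ^ k) x + a) by abel]
    simp only [pow_zero, Module.End.one_apply, sub_zero]
    constructor
    · intro hst
      have := hsub i _ hst (by
        rw [sub_sub, add_comm _ u]
        linarith [hA.pos])
      simpa using this
    · exact fun hst => hA.mem_of_translate h hsub hst hs
  · rw [hut, show u' + ((Q ^ k) x + a) - (Q ^ k) w = u' + a + (Q ^ k) (x - w) by
      rw [map_sub]; abel]
    have h1 : ‖u'‖ ≤ ∑ u ∈ U, ‖u‖ :=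
      Finset.single_le_sum (f := fun u : Euc d => ‖u‖) (fun _ _ => norm_nonneg _) hu'
    have h2 : ‖(Q ^ k) (x - w)‖ ≤ C * R₀ :=
      (hC _).trans (mul_le_mul_of_nonneg_left hxw (by linarith))
    linarith [norm_add₃_le (a := u') (b := a) (c := (Q ^ k) (x - w))]

/-- Repetitivity at all levels, with the same constant. -/
theorem exists_return_pow (h : IsStrongSubstitution Λ Q D) (R : ℝ) :
    ∃ R' : ℝ, ∀ n c w, ∃ t ∈ Xi Λ, AgreeOn Λ Q n ((Q ^ n) t) 0 (c + t) R ∧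
      ‖c + t - w‖ ≤ R' := by
  obtain ⟨A, κ, hA⟩ := h.exists_tileSystem
  obtain ⟨R₀, hR₀, hdense⟩ := h.dense
  obtain ⟨j₀, -⟩ := h.good
  -- Inflation costs κ, and moving the centre from u to c costs R₀.
  obtain ⟨R', hR'⟩ := h.exists_return j₀ (R₀ + R + κ)
  refine ⟨R₀ + R', fun n c w => ?_⟩
  obtain ⟨u, hu, huc⟩ := hdense j₀ c
  obtain ⟨t, htu, hag, hbd⟩ := hR' u hu w
  refine ⟨t, ?_, ?_, ?_⟩
  · simpa using sub_mem_Xi htu hu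
  · have h1 := hag.inflate h hA n
    rw [map_zero] at h1
    refine h1.mono ?_
    rw [add_sub_add_right_eq_sub, norm_sub_rev]
    linarith
  · rw [show c + t - w = -(u - c) + (u + t - w) by abel]
    refine (norm_add_le _ _).trans ?_
    rw [norm_neg]
    linarith

/-- Translations by `Q ^ n τ` with bounded `τ` that preserve `Λ` on a large inflated ball are
periods. -/
theorem exists_repulsion (h : IsStrongSubstitution Λ Q D) (δ : ℝ) :
    ∃ r : ℝ, ∀ n w τ, ‖τ‖ ≤ δ → AgreeOn Λ Q n ((Q ^ n) τ) 0 w r → (Q ^ n) τ ∈ periods Λ := by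
  obtain ⟨r, hr⟩ := h.exists_return_pow δ
  refine ⟨r, fun n w τ hτ hag => mem_periods.2 fun i y => ?_⟩
  obtain ⟨c, rfl⟩ := h.pow_surjective n y
  -- The δ-neighbourhood of c, inflated by Q^n, recurs inside the ball of agreement, where the
  -- points y and y - Q^nτ can be compared.
  obtain ⟨t, -, hagt, htw⟩ := hr n c w
  have h1 := hagt i (c + t) (by simpa using (norm_nonneg τ).trans hτ)
  have h2 := hagt i (c + t - τ) (by
    rwa [sub_sub, add_comm τ, ← sub_sub, sub_self, zero_sub, norm_neg])
  have h3 := hag i (c + t) htw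
  rw [show (Q ^ n) (c + t) - (Q ^ n) t = (Q ^ n) c by rw [← map_sub, add_sub_cancel_right]] at h1
  rw [show (Q ^ n) (c + t - τ) - (Q ^ n) t = (Q ^ n) c - (Q ^ n) τ by
    simp only [← map_sub]; congr 1; abel] at h2
  rw [map_sub] at h2
  simp only [sub_zero] at h1 h2 h3
  rw [h2, h3, ← h1]

/-- A bounded number of pairwise incongruent translates can agree on a large inflated ball. -/
theorem exists_card_bound (h : IsStrongSubstitution Λ Q D) :
    ∃ (N : ℕ) (r : ℝ), ∀ n w (x : Fin N → Euc d), (∀ s, AgreeOn Λ Q n (x s) 0 w r) →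
      ∃ s t, s ≠ t ∧ x s - x t ∈ xiNhd Λ Q n := by
  obtain ⟨A, κ, hA⟩ := h.exists_tileSystem
  obtain ⟨R₀, hR₀, hdense⟩ := h.dense
  obtain ⟨j₀, -⟩ := h.good
  obtain ⟨r, hr⟩ := h.exists_repulsion (2 * R₀)
  have hfin := h.finite_patches j₀ (r + R₀ + κ)
  refine ⟨hfin.toFinset.card + 1, r, fun n w x hx => ?_⟩
  choose y hy using fun s => h.pow_surjective n (x s)
  -- The pigeonhole gives s ≠ t with equal patches at u s and u t. Then x s - x t = Q^n(u t - u s) +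
  -- Q^nτ with ‖τ‖ ≤ 2R₀, and Q^nτ is a period by `exists_repulsion`.
  choose u hu hub using fun s => hdense j₀ (w - y s)
  obtain ⟨s, -, t, -, hst, heq⟩ := Finset.exists_ne_map_eq_of_card_lt_of_maps_to
    (s := Finset.univ) (t := hfin.toFinset) (by simp)
    (f := fun s => patch Λ (r + R₀ + κ) (u s)) (fun s _ => by
      simpa using ⟨u s, hu s, rfl⟩)
  refine ⟨s, t, hst, ?_⟩
  have hpatch : AgreeOn Λ Q 0 (-u s) (-u t) 0 (r + R₀ + κ) := by
    intro i v hv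
    rw [sub_zero] at hv
    have h1 : v ∈ patch Λ (r + R₀ + κ) (u s) i ↔ v ∈ patch Λ (r + R₀ + κ) (u t) i := by
      rw [heq]
    simp only [patch, Set.mem_ofPred_eq, hv, true_and] at h1
    simpa [add_comm] using h1
  have h2 := (hpatch.inflate h hA n).translate (u s + y s)
  set τ := y s + u s - (y t + u t) with hτ
  have hτb : ‖τ‖ ≤ 2 * R₀ := by
    rw [hτ, show y s + u s - (y t + u t) = (u s - (w - y s)) - (u t - (w - y t)) by abel]
    linarith [norm_sub_le (u s - (w - y s)) (u t - (w - y t)), hub s, hub t]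
  have e1 : (Q ^ n) (-u s) + (Q ^ n) (u s + y s) = x s := by
    rw [← map_add, neg_add_cancel_left, hy]
  have e2 : (Q ^ n) (-u t) + (Q ^ n) (u s + y s) = x t + (Q ^ n) τ := by
    rw [← hy t, ← map_add, ← map_add]
    congr 1
    rw [hτ]
    abel
  rw [e1, e2, zero_add] at h2
  have h3 : AgreeOn Λ Q n (x s) (x t + (Q ^ n) τ) w r := h2.mono (by
    have := hub s
    rw [show w - (u s + y s) = -(u s - (w - y s)) by abel, norm_neg]
    linarith)
  have h4 : AgreeOn Λ Q n ((Q ^ n) τ) 0 (w - y t) r := by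
    have := ((h3.symm.trans (hx s)).trans (hx t).symm).translate (-y t)
    rw [map_neg, hy t] at this
    simpa [sub_eq_add_neg, add_comm] using this
  refine ⟨u t - u s, sub_mem_Xi (hu t) (hu s), _, hr n _ τ hτb h4, ?_⟩
  rw [← hy s, ← hy t, ← map_sub, ← map_add]
  congr 1
  rw [hτ]
  abel

end IsStrongSubstitution

end Repetitivity

/-! ### From agreement on large balls to congruence modulo Q^nΞ + 𝒦. -/

section Recognizability

variable {d m : ℕ} {Λ : MultiColourSet d m} {Q : Euc d →ₗ[ℝ] Euc d}
  {D : Fin m → Fin m → Finset (Euc d)}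

theorem exists_succ_not_of_not {P : ℕ → Prop} (h0 : P 0) {N : ℕ} (hN : ¬ P N) :
    ∃ n, P n ∧ ¬ P (n + 1) := by
  by_contra! hcon
  exact hN (Nat.rec h0 hcon N)

namespace IsStrongSubstitution

theorem agreeOn_zero_of_agreeOn (h : IsStrongSubstitution Λ Q D) {n : ℕ} {x y c : Euc d} {R : ℝ}
    (hag : AgreeOn Λ Q n x y c R) : AgreeOn Λ Q 0 x y ((Q ^ n) c) R := by
  intro i s hs
  obtain ⟨s, rfl⟩ := h.pow_surjective n s
  rw [← map_sub] at hs
  simpa using hag i s ((h.norm_le_norm_pow n _).trans hs)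

/-- Translates that agree with `Λ` on large balls are trivial modulo `Q^n Ξ + 𝒦`, after
application of a fixed power of `Q`. -/
theorem exists_pow_map_mem_xiNhd (h : IsStrongSubstitution Λ Q D) :
    ∃ p : ℕ, ∀ n, ∃ R : ℝ, ∀ x c, AgreeOn Λ Q 0 x 0 c R → (Q ^ p) x ∈ xiNhd Λ Q n := by
  obtain ⟨A, κ, hA⟩ := h.exists_tileSystem
  obtain ⟨R₀, hR₀, hdense⟩ := h.dense
  obtain ⟨j₀, -⟩ := h.good
  obtain ⟨N, r, hN⟩ := h.exists_card_bound
  -- N is extremal: for some n₀, arbitrarily large balls carry N agreeing translates that are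
  -- pairwise incongruent modulo Q^{n₀}Ξ + 𝒦, while N + 1 translates have this property for no
  -- level.
  obtain ⟨N, ⟨n₀, hB⟩, hB'⟩ := exists_succ_not_of_not (N := N)
    (P := fun N => ∃ n₀, ∀ R : ℝ, ∃ (x : Fin N → Euc d) (c : Euc d),
      (∀ s, AgreeOn Λ Q 0 (x s) 0 c R) ∧ ∀ s t, s ≠ t → x s - x t ∉ xiNhd Λ Q n₀)
    ⟨0, fun R => ⟨fun _ => 0, 0, fun s => s.elim0, fun s => s.elim0⟩⟩ (by
      rintro ⟨n, hn⟩
      obtain ⟨C, hC1, hC⟩ := exists_norm_pow_le Q n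
      obtain ⟨x, c, hx, hne⟩ := hn (C * r)
      obtain ⟨w, rfl⟩ := h.pow_surjective n c
      obtain ⟨s, t, hst, hmem⟩ := hN n w x (fun s i v hv => by
        have := hx s i ((Q ^ n) v) (by
          rw [← map_sub]
          exact (hC _).trans (mul_le_mul_of_nonneg_left hv (by linarith)))
        simpa using this)
      exact hne s t hst hmem)
  push Not at hB'
  refine ⟨n₀ + 2, fun n => ?_⟩
  set n₁ := max n n₀ + 2 with hn₁
  have hn : n + 2 ≤ n₁ := by omega
  have hn₀ : n₀ + 2 ≤ n₁ := by omega
  obtain ⟨R₁, hR₁⟩ := hB' n₁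
  have hR₁ : ∀ (x : Fin (N + 1) → Euc d) (c : Euc d), (∀ s, AgreeOn Λ Q 0 (x s) 0 c R₁) →
      ∃ s t, s ≠ t ∧ x s - x t ∈ xiNhd Λ Q n₁ := hR₁
  refine ⟨max R₁ 0 + κ + R₀, fun x c hxc => ?_⟩
  set p := n₀ + 2 with hp
  have hxXi : x ∈ Xi Λ := by
    obtain ⟨u, hu, huc⟩ := hdense j₀ c
    have := hxc j₀ u (by linarith [le_max_right R₁ 0, hA.pos])
    simp only [pow_zero, Module.End.one_apply, sub_zero] at this
    simpa using sub_mem_Xi hu (this.2 hu)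
  set z := (Q ^ p) x with hz
  have hzag : AgreeOn Λ Q 0 z 0 ((Q ^ p) c) R₁ := by
    have h1 : AgreeOn Λ Q 0 x 0 c (R₁ + κ) := hxc.mono (by
      rw [sub_self, norm_zero]
      linarith [le_max_left R₁ 0])
    have h2 := h.agreeOn_zero_of_agreeOn (h1.inflate h hA p)
    rwa [map_zero] at h2
  obtain ⟨R', hR'⟩ := h.exists_return_pow R₁
  obtain ⟨C, hC1, hC⟩ := exists_norm_pow_le Q n₁
  obtain ⟨y, c₂, hy, hyne⟩ := hB (C * R' + R₁)
  obtain ⟨c₁, hc₁⟩ := h.pow_surjective n₁ ((Q ^ p) c)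
  obtain ⟨w, rfl⟩ := h.pow_surjective n₁ c₂
  -- Translation by T = Q^{n₁}t ∈ Q^{n₁}Ξ carries the agreement for z to a place where all the y s
  -- agree with Λ.
  obtain ⟨t, ht, htag, htw⟩ := hR' n₁ c₁ w
  set T := (Q ^ n₁) t with hT
  have hTag : AgreeOn Λ Q 0 T 0 ((Q ^ n₁) (c₁ + t)) R₁ := h.agreeOn_zero_of_agreeOn htag
  have hzT : AgreeOn Λ Q 0 (z + T) 0 ((Q ^ n₁) (c₁ + t)) R₁ := by
    have := hzag.translate T
    simp only [pow_zero, Module.End.one_apply, zero_add] at this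
    rw [← hc₁, hT, ← map_add] at this
    exact this.trans hTag
  have hy' : ∀ s, AgreeOn Λ Q 0 (y s) 0 ((Q ^ n₁) (c₁ + t)) R₁ := fun s => (hy s).mono (by
    rw [← map_sub]
    have := (hC (c₁ + t - w)).trans (mul_le_mul_of_nonneg_left htw (by linarith))
    linarith)
  -- Adding v to the y s gives N + 1 translates, so two are congruent at level n₁. The y s are
  -- incongruent already at level n₀, so v is one of the two.
  have hmerge : ∀ v, AgreeOn Λ Q 0 v 0 ((Q ^ n₁) (c₁ + t)) R₁ → ∃ s, v - y s ∈ xiNhd Λ Q n₁ := by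
    intro v hv
    obtain ⟨s, s', hne, hmem⟩ := hR₁ (Fin.cons v y) _ (Fin.cases hv hy')
    induction s using Fin.cases with
    | zero =>
      induction s' using Fin.cases with
      | zero => exact absurd rfl hne
      | succ s' => exact ⟨s', by simpa using hmem⟩
    | succ s =>
      induction s' using Fin.cases with
      | zero =>
        refine ⟨s, ?_⟩
        have := neg_mem_xiNhd hmem
        rw [neg_sub] at this
        simpa using this
      | succ s' =>
        refine absurd (h.xiNhd_antitone (show n₀ ≤ n₁ by omega) hmem) ?_
        simpa using hyne s s' (fun he => hne (by rw [he]))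
  obtain ⟨s, hs⟩ := hmerge _ hzT
  obtain ⟨s₀, hs₀⟩ := hmerge 0 fun i v _ => Iff.rfl
  have hs₀ : y s₀ ∈ xiNhd Λ Q n₁ := by simpa using neg_mem_xiNhd hs₀
  have hTm : T ∈ xiNhd Λ Q n₁ := pow_map_mem_xiNhd ht
  have hzm : z ∈ xiNhd Λ Q p := pow_map_mem_xiNhd hxXi
  -- z ∈ Q^pΞ makes z + T and 0 congruent at a coarse level; p = n₀ + 2 pays for the two rounds of
  -- addition. So both merge with the same y s, which yields the congruence of z at level n.
  have hss : s = s₀ := by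
    by_contra hne
    refine hyne s s₀ hne ?_
    have e : y s - y s₀ = (z + T) - ((z + T - y s) + y s₀) := by abel
    rw [e]
    have ha := h.xiNhd_antitone hn₀
    exact h.sub_mem_xiNhd (h.add_mem_xiNhd hzm (ha hTm)) (h.add_mem_xiNhd (ha hs) (ha hs₀))
  subst hss
  have e : z = (z + T - y s) + (y s - T) := by abel
  rw [e]
  have ha := h.xiNhd_antitone hn
  exact h.add_mem_xiNhd (h.xiNhd_antitone (Nat.le_succ _) (ha hs))
    (h.sub_mem_xiNhd (ha hs₀) (ha hTm))

/-- The vectors that `Q ^ p` maps to periods fall into finitely many classes modulo periods. -/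
theorem exists_finite_periods (h : IsStrongSubstitution Λ Q D) (p : ℕ) :
    ∃ T : Set (Euc d), T.Finite ∧ ∀ l, (Q ^ p) l ∈ periods Λ → ∃ t ∈ T, l - t ∈ periods Λ := by
  obtain ⟨r, hr, hsep⟩ := h.separated
  obtain ⟨j₀, -⟩ := h.good
  set M := AddSubgroup.toIntSubmodule (periodGroup Λ) with hM
  have hmem : ∀ x, x ∈ M ↔ x ∈ periods Λ := fun x => Iff.rfl
  have : DiscreteTopology M := by
    refine DiscreteTopology.of_forall_le_norm hr fun x hx => ?_
    obtain ⟨u, hu⟩ := h.set_nonempty j₀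
    have hux : u - x ∈ Λ j₀ := (mem_periods.1 ((hmem _).1 x.2) j₀ u).2 hu
    have hne : (x : Euc d) ≠ 0 := fun h0 => hx (Subtype.ext h0)
    simpa [dist_eq_norm] using hsep j₀ u hu _ hux (fun he => hne (sub_eq_self.1 he.symm))
  -- The periods form a discrete group, free of finite rank, so the injective map Q^p has image of
  -- finite index. The class of l modulo 𝒦 is determined by that of Q^p l modulo Q^p𝒦.
  let f : M →ₗ[ℤ] M := ((Q ^ p).restrictScalars ℤ).restrict (p := M) (q := M)
    (fun x hx => pow_map_mem_periods h.fixed p hx)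
  have hf : Function.Injective f := fun x y hxy =>
    Subtype.ext (h.pow_injective p (congrArg Subtype.val hxy))
  have hfin : Finite (M ⧸ LinearMap.range f) :=
    Submodule.finiteQuotientOfFreeOfRankEq _ (LinearMap.finrank_range_of_inj hf)
  refine ⟨(Q ^ p) ⁻¹' (Set.range fun q : M ⧸ LinearMap.range f => ((Quotient.out q : M) : Euc d)),
    (Set.finite_range _).preimage (h.pow_injective p).injOn, fun l hl => ?_⟩
  set q : M ⧸ LinearMap.range f := Submodule.Quotient.mk ⟨_, hl⟩ with hq
  obtain ⟨t, ht⟩ := h.pow_surjective p ((Quotient.out q : M) : Euc d)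
  refine ⟨t, ⟨q, ht.symm⟩, ?_⟩
  have h1 : Submodule.Quotient.mk (p := LinearMap.range f) (Quotient.out q) = q :=
    Quotient.out_eq q
  rw [hq, eq_comm, Submodule.Quotient.eq] at h1
  obtain ⟨k, hk⟩ := h1
  have h2 : (Q ^ p) k = (Q ^ p) l - (Q ^ p) t := by
    rw [ht]
    exact congrArg Subtype.val hk
  rw [← map_sub] at h2
  rw [← h.pow_injective p h2]
  exact k.2

end IsStrongSubstitution

end Recognizability

/-! ### Counting points in van Hove sequences -/

/-- The number of elements of a set, in `[0, ∞]`. -/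
noncomputable def setCount {α : Type*} (S : Set α) : ℝ≥0∞ := ((S.encard : ℕ∞) : ℝ≥0∞)

section SetCount

variable {α : Type*}

theorem setCount_mono {S T : Set α} (h : S ⊆ T) : setCount S ≤ setCount T :=
  ENat.toENNReal_mono (Set.encard_le_encard h)

theorem setCount_union_le (S T : Set α) : setCount (S ∪ T) ≤ setCount S + setCount T := by
  rw [setCount, setCount, setCount, ← ENat.toENNReal_add]
  exact ENat.toENNReal_mono (Set.encard_union_le S T)

theorem setCount_biUnion_le {ι : Type*} (s : Finset ι) (S : ι → Set α) :
    setCount (⋃ i ∈ s, S i) ≤ ∑ i ∈ s, setCount (S i) := by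
  classical
  induction s using Finset.induction_on with
  | empty => simp [setCount]
  | insert i s hi ih =>
    rw [Finset.set_biUnion_insert, Finset.sum_insert hi]
    exact (setCount_union_le _ _).trans (add_le_add_right ih _)

theorem setCount_iUnion_le {ι : Type*} [Fintype ι] (S : ι → Set α) :
    setCount (⋃ i, S i) ≤ ∑ i, setCount (S i) := by
  simpa using setCount_biUnion_le Finset.univ S

theorem setCount_image_le {β : Type*} (f : α → β) (S : Set α) :
    setCount (f '' S) ≤ setCount S :=
  ENat.toENNReal_mono (Set.encard_image_le f S)

end SetCount

theorem ennreal_limsup_add_le (u v : ℕ → ℝ≥0∞) :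
    limsup (fun n => u n + v n) atTop ≤ limsup u atTop + limsup v atTop := by
  refine ENNReal.le_of_forall_pos_le_add fun ε hε hfin => ?_
  obtain ⟨hu, hv⟩ := ENNReal.add_lt_top.1 hfin
  have hε2 : (ε : ℝ≥0∞) / 2 ≠ 0 := by simpa using hε.ne'
  have h1 := eventually_lt_of_limsup_lt (ENNReal.lt_add_right hu.ne hε2)
  have h2 := eventually_lt_of_limsup_lt (ENNReal.lt_add_right hv.ne hε2)
  refine limsup_le_of_le (by isBoundedDefault) ?_
  filter_upwards [h1, h2] with n hn1 hn2
  refine (add_le_add hn1.le hn2.le).trans (le_of_eq ?_)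
  rw [add_add_add_comm, ENNReal.add_halves]

/-- Turns a packing bound into a density bound; W is the boundary term that the van Hove property
removes. -/
theorem limsup_div_le_of_mul_le {c V W : ℕ → ℝ≥0∞} {w N : ℝ≥0∞} (hw : w ≠ 0) (hw' : w ≠ ∞)
    (hN : N ≠ ∞) (hV : ∀ n, V n ≠ 0) (hV' : ∀ n, V n ≠ ∞)
    (hW : Tendsto (fun n => W n / V n) atTop (𝓝 0)) (h : ∀ n, c n * w ≤ N * (V n + W n)) :
    limsup (fun n => c n / V n) atTop ≤ N / w := by
  have hle : ∀ n, c n / V n ≤ N / w * (1 + W n / V n) := by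
    intro n
    rw [← ENNReal.div_self (hV n) (hV' n), ENNReal.div_add_div_same]
    have h1 : c n ≤ N * (V n + W n) / w := (ENNReal.le_div_iff_mul_le (Or.inl hw) (Or.inl hw')).2 (h n)
    refine (ENNReal.div_le_div_right h1 _).trans (le_of_eq ?_)
    simp only [div_eq_mul_inv]
    ring
  have hlim : Tendsto (fun n => N / w * (1 + W n / V n)) atTop (𝓝 (N / w)) := by
    have h1 : Tendsto (fun n => 1 + W n / V n) atTop (𝓝 (1 + 0)) := tendsto_const_nhds.add hW
    have := ENNReal.Tendsto.const_mul (a := N / w) h1 (Or.inr (ENNReal.div_ne_top hN hw))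
    simpa using this
  exact (limsup_le_limsup (Eventually.of_forall hle)).trans hlim.limsup_eq.le

section VanHove

variable {d : ℕ} {F : ℕ → Set (Euc d)}

namespace IsVanHove

theorem volume_ne_zero (hF : IsVanHove F) (n : ℕ) : volume (F n) ≠ 0 := (hF.pos n).ne'

theorem volume_ne_top (hF : IsVanHove F) (n : ℕ) : volume (F n) ≠ ∞ :=
  (hF.bounded n).measure_lt_top.ne

end IsVanHove

theorem mem_cthickening_frontier {S : Set (Euc d)} {p q : Euc d} {ρ : ℝ} (hp : p ∈ S)
    (hq : q ∉ S) (hpq : dist p q ≤ ρ) : p ∈ Metric.cthickening ρ (frontier S) := by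
  obtain ⟨y, hy, hpy⟩ := exists_mem_frontier_infDist_compl_eq_dist hp
    (fun h => hq (h ▸ Set.mem_univ q))
  refine Metric.mem_cthickening_of_dist_le p y ρ _ hy ?_
  rw [← hpy]
  exact (Metric.infDist_le_dist_of_mem (show q ∈ Sᶜ from hq)).trans hpq

theorem mem_cthickening_frontier' {S : Set (Euc d)} {p q : Euc d} {ρ : ℝ} (hp : p ∈ S)
    (hq : q ∉ S) (hpq : dist p q ≤ ρ) : q ∈ Metric.cthickening ρ (frontier S) := by
  rw [← frontier_compl]
  exact mem_cthickening_frontier hq (fun h => h hp) (by rwa [dist_comm])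

theorem mem_union_cthickening_frontier {S : Set (Euc d)} {p q : Euc d} {ρ : ℝ} (hp : p ∈ S)
    (hpq : dist p q ≤ ρ) : q ∈ S ∪ Metric.cthickening ρ (frontier S) := by
  by_cases hq : q ∈ S
  · exact Or.inl hq
  · exact Or.inr (mem_cthickening_frontier' hp hq hpq)

/-- The packing bound for the image of a separated set under an invertible affine map. -/
theorem setCount_mul_volume_le {Q : Euc d →ₗ[ℝ] Euc d} {k : ℕ}
    (hinj : Function.Injective (Q ^ k)) {X : Set (Euc d)} {r : ℝ}
    (hsep : ∀ u ∈ X, ∀ v ∈ X, u ≠ v → r ≤ dist u v) (b : Euc d) {G Z : Set (Euc d)}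
    (hZ : ∀ u ∈ X, (Q ^ k) u + b ∈ G → ∀ p, dist p u < r / 2 → (Q ^ k) p + b ∈ Z) :
    setCount {y ∈ G | ∃ u ∈ X, y = (Q ^ k) u + b} *
      (ENNReal.ofReal (|LinearMap.det Q| ^ k) * volume (Metric.ball (0 : Euc d) (r / 2))) ≤
      volume Z := by
  set S := {u ∈ X | (Q ^ k) u + b ∈ G} with hS
  set B : S → Set (Euc d) := fun u =>
    (fun p => p + -b) ⁻¹' ((Q ^ k) '' Metric.ball (u : Euc d) (r / 2)) with hB
  have himg : {y ∈ G | ∃ u ∈ X, y = (Q ^ k) u + b} ⊆ (fun u => (Q ^ k) u + b) '' S := by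
    rintro y ⟨hy, u, hu, rfl⟩
    exact ⟨u, ⟨hu, hy⟩, rfl⟩
  have hvol : ∀ u, volume (B u) =
      ENNReal.ofReal (|LinearMap.det Q| ^ k) * volume (Metric.ball (0 : Euc d) (r / 2)) := by
    intro u
    rw [hB]
    simp only
    rw [measure_preimage_add_right, volume_image_pow, Measure.addHaar_ball_center]
  have hmeas : ∀ u, MeasurableSet (B u) := fun u =>
    (measurable_add_const (-b)) (LinearMap.isOpenMap_of_finiteDimensional _
      (LinearMap.injective_iff_surjective.1 hinj) _ Metric.isOpen_ball).measurableSet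
  have hdisj : Pairwise (Function.onFun Disjoint B) := by
    intro u v huv
    refine Disjoint.preimage _ ?_
    rw [Set.disjoint_image_iff hinj]
    refine Metric.ball_disjoint_ball ?_
    rw [add_halves]
    exact hsep _ u.2.1 _ v.2.1 fun he => huv (Subtype.ext he)
  have hsub : (⋃ u, B u) ⊆ Z := by
    refine Set.iUnion_subset fun u p hp => ?_
    obtain ⟨s, hs, hsp⟩ := hp
    have := hZ u u.2.1 u.2.2 s hs
    rw [hsp] at this
    simpa using this
  calc _ ≤ setCount S * _ :=
        mul_le_mul_left ((setCount_mono himg).trans (setCount_image_le _ _)) _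
    _ = ∑' u : S, volume (B u) := by simp only [hvol, ENNReal.tsum_set_const, setCount]
    _ ≤ volume (⋃ u, B u) := tsum_meas_le_meas_iUnion_of_disjoint volume hmeas hdisj
    _ ≤ volume Z := measure_mono hsub

end VanHove

/-! ### The pseudometric ρ and agreement on balls. -/

section Rho

variable {d m : ℕ} {Λ : MultiColourSet d m} {Q : Euc d →ₗ[ℝ] Euc d}
  {D : Fin m → Fin m → Finset (Euc d)} {F : ℕ → Set (Euc d)}

theorem rho_eq (Λ' Λ'' : MultiColourSet d m) : rho F Λ' Λ'' =
    limsup (fun n => (∑ i, setCount (symmDiff (Λ' i) (Λ'' i) ∩ F n)) / volume (F n)) atTop := rfl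

theorem rho_self (Λ' : MultiColourSet d m) : rho F Λ' Λ' = 0 := by
  simp [rho_eq, setCount]

theorem rho_comm (Λ' Λ'' : MultiColourSet d m) : rho F Λ' Λ'' = rho F Λ'' Λ' := by
  simp only [rho_eq, symmDiff_comm]

theorem rho_triangle (Λ₁ Λ₂ Λ₃ : MultiColourSet d m) :
    rho F Λ₁ Λ₃ ≤ rho F Λ₁ Λ₂ + rho F Λ₂ Λ₃ := by
  simp only [rho_eq]
  refine le_trans (limsup_le_limsup (Eventually.of_forall fun n => ?_))
    (ennreal_limsup_add_le _ _)
  simp only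
  rw [← ENNReal.add_div, ← Finset.sum_add_distrib]
  refine ENNReal.div_le_div_right (Finset.sum_le_sum fun i _ => ?_) _
  refine le_trans (setCount_mono ?_) (setCount_union_le _ _)
  rw [← Set.union_inter_distrib_right]
  exact Set.inter_subset_inter_left _ (symmDiff_triangle (Λ₁ i) (Λ₂ i) (Λ₃ i))

theorem translateMulti_add (x y : Euc d) :
    translateMulti (x + y) Λ = translateMulti x (translateMulti y Λ) := by
  funext i
  ext p
  simp only [mem_translateMulti, sub_sub, add_comm x]

theorem translateMulti_zero : translateMulti 0 Λ = Λ := by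
  funext i
  ext p
  simp [mem_translateMulti]

/-- Invariance of `ρ` under translations. -/
theorem rho_translate_le (hF : IsVanHove F)
    (hsep : ∃ r : ℝ, 0 < r ∧ ∀ i, ∀ u ∈ Λ i, ∀ v ∈ Λ i, u ≠ v → r ≤ dist u v) (x y z : Euc d) :
    rho F (translateMulti x (translateMulti y Λ)) (translateMulti x (translateMulti z Λ)) ≤
      rho F (translateMulti y Λ) (translateMulti z Λ) := by
  obtain ⟨r, hr, hsep⟩ := hsep
  set v := volume (Metric.ball (0 : Euc d) (r / 2)) with hv
  have hv0 : v ≠ 0 := (Metric.measure_ball_pos _ _ (by linarith)).ne'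
  have hv1 : v ≠ ∞ := measure_ball_lt_top.ne
  set W : ℕ → ℝ≥0∞ := fun n => volume (Metric.cthickening (‖x‖ + r) (frontier (F n))) with hW
  have hWlim := hF.tendsto (‖x‖ + r) (by positivity)
  -- Shifting the window F n by x matters only within ‖x‖ of its frontier; disjoint balls of radius
  -- r/2 bound the number of points there.
  have hcount : ∀ n i t, setCount (translateMulti t Λ i ∩
      Metric.cthickening ‖x‖ (frontier (F n))) ≤ W n / v := by
    intro n i t
    rw [ENNReal.le_div_iff_mul_le (Or.inl hv0) (Or.inl hv1)]
    have := setCount_mul_volume_le (Q := (LinearMap.id : Euc d →ₗ[ℝ] Euc d)) (k := 0)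
      (fun a b hab => by simpa using hab) (hsep i) t
      (G := Metric.cthickening ‖x‖ (frontier (F n)))
      (Z := Metric.cthickening (‖x‖ + r) (frontier (F n))) (fun u hu hmem p hp => by
        rw [add_comm ‖x‖]
        refine Metric.cthickening_cthickening_subset hr.le (norm_nonneg x) _ ?_
        refine Metric.mem_cthickening_of_dist_le _ _ _ _ hmem ?_
        simp only [pow_zero, Module.End.one_apply, dist_add_right]
        linarith)
    simp only [pow_zero, ENNReal.ofReal_one, one_mul, Module.End.one_apply] at this
    refine le_trans (mul_le_mul_left (setCount_mono ?_) _) this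
    rintro p ⟨hp, hpG⟩
    exact ⟨hpG, p - t, mem_translateMulti.1 hp, by abel⟩
  have hle : ∀ n, (∑ i, setCount (symmDiff (translateMulti x (translateMulti y Λ) i)
      (translateMulti x (translateMulti z Λ) i) ∩ F n)) / volume (F n) ≤
      (∑ i, setCount (symmDiff (translateMulti y Λ i) (translateMulti z Λ i) ∩ F n)) /
        volume (F n) + (2 * m / v) * (W n / volume (F n)) := by
    intro n
    have h1 : ∀ i, setCount (symmDiff (translateMulti x (translateMulti y Λ) i)
        (translateMulti x (translateMulti z Λ) i) ∩ F n) ≤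
        setCount (symmDiff (translateMulti y Λ i) (translateMulti z Λ i) ∩ F n) +
          2 * (W n / v) := by
      intro i
      have hsub : symmDiff (translateMulti x (translateMulti y Λ) i)
          (translateMulti x (translateMulti z Λ) i) ∩ F n ⊆ (fun p => x + p) ''
          ((symmDiff (translateMulti y Λ i) (translateMulti z Λ i) ∩ F n) ∪
          ((translateMulti y Λ i ∩ Metric.cthickening ‖x‖ (frontier (F n))) ∪
           (translateMulti z Λ i ∩ Metric.cthickening ‖x‖ (frontier (F n))))) := by
        rintro p ⟨hp, hpF⟩
        have hp' : p - x ∈ symmDiff (translateMulti y Λ i) (translateMulti z Λ i) := by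
          simp only [Set.mem_symmDiff] at hp ⊢
          rwa [mem_translateMulti (x := x), mem_translateMulti (x := x)] at hp
        refine ⟨p - x, ?_, by simp⟩
        by_cases hpx : p - x ∈ F n
        · exact Or.inl ⟨hp', hpx⟩
        · have hth := mem_cthickening_frontier' (ρ := ‖x‖) hpF hpx (by simp)
          rcases hp' with hp' | hp'
          · exact Or.inr (Or.inl ⟨hp'.1, hth⟩)
          · exact Or.inr (Or.inr ⟨hp'.1, hth⟩)
      refine (setCount_mono hsub).trans ((setCount_image_le _ _).trans
        ((setCount_union_le _ _).trans (add_le_add_right ?_ _)))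
      rw [two_mul]
      exact (setCount_union_le _ _).trans (add_le_add (hcount n i y) (hcount n i z))
    refine (ENNReal.div_le_div_right (Finset.sum_le_sum fun i _ => h1 i) _).trans (le_of_eq ?_)
    rw [Finset.sum_add_distrib, ENNReal.add_div]
    congr 1
    simp only [Finset.sum_const, Finset.card_univ, Fintype.card_fin, nsmul_eq_mul, div_eq_mul_inv]
    ring
  rw [rho_eq, rho_eq]
  refine (limsup_le_limsup (Eventually.of_forall hle)).trans ((ennreal_limsup_add_le _ _).trans ?_)
  have hlim : Tendsto (fun n => (2 * m / v) * (W n / volume (F n))) atTop (𝓝 0) := by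
    have := ENNReal.Tendsto.const_mul (a := 2 * m / v) hWlim
      (Or.inr (ENNReal.div_ne_top (ENNReal.mul_ne_top (by simp) (by simp)) hv0))
    simpa using this
  rw [hlim.limsup_eq, add_zero]

/-- If `x + Λ` is close to `Λ`, then the two agree on some large ball. -/
theorem exists_agreeOn_of_rho_lt (hF : IsVanHove F) (R : ℝ) :
    ∃ ε : ℝ≥0∞, 0 < ε ∧ ∀ x, rho F (translateMulti x Λ) Λ < ε → ∃ c, AgreeOn Λ Q 0 x 0 c R := by
  set R₁ := max R 1 with hR₁
  have hR₁0 : 0 < R₁ := lt_max_of_lt_right one_pos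
  set v := volume (Metric.closedBall (0 : Euc d) R₁) with hv
  have hv0 : v ≠ 0 := (Metric.measure_closedBall_pos _ _ hR₁0).ne'
  have hv1 : v ≠ ∞ := measure_closedBall_lt_top.ne
  -- Without agreement on any R-ball, the R₁-balls around points of disagreement cover F n up to its
  -- boundary zone, which forces density about 1/v. The threshold is half of that.
  refine ⟨(2 * v)⁻¹, ENNReal.inv_pos.2 (ENNReal.mul_ne_top (by simp) hv1), fun x hx => ?_⟩
  by_contra! hcon
  rw [rho_eq] at hx
  set S : Fin m → Set (Euc d) := fun i => symmDiff (translateMulti x Λ i) (Λ i) with hS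
  have hmeet : ∀ c, ∃ i, ∃ s ∈ S i, dist c s ≤ R₁ := by
    intro c
    have := hcon c
    simp only [AgreeOn, not_forall] at this
    obtain ⟨i, s, hs, hne⟩ := this
    refine ⟨i, s, ?_, ?_⟩
    · simp only [hS, Set.mem_symmDiff, mem_translateMulti]
      simp only [pow_zero, Module.End.one_apply, sub_zero] at hne
      tauto
    · rw [dist_comm, dist_eq_norm]
      exact hs.trans (le_max_left _ _)
  have hball : ∀ T : Set (Euc d), volume (⋃ s ∈ T, Metric.closedBall s R₁) ≤ setCount T * v := by
    intro T
    by_cases hT : T.Finite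
    · have h1 : (⋃ s ∈ T, Metric.closedBall s R₁) = ⋃ s ∈ hT.toFinset, Metric.closedBall s R₁ := by
        simp
      rw [h1]
      refine (measure_biUnion_finset_le _ _).trans (le_of_eq ?_)
      simp only [Measure.addHaar_closedBall_center, Finset.sum_const, nsmul_eq_mul, setCount,
        hT.encard_eq_coe_toFinset_card]
      simp
      rfl
    · have : setCount T = ∞ := by
        rw [setCount, Set.encard_eq_top_iff.2 hT, ENat.toENNReal_top]
      rw [this, ENNReal.top_mul hv0]
      exact le_top
  have hVn : ∀ n, volume (F n) ≤ volume (Metric.cthickening R₁ (frontier (F n))) +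
      (∑ i, setCount (S i ∩ F n)) * v := by
    intro n
    have hsub : F n ⊆ Metric.cthickening R₁ (frontier (F n)) ∪
        ⋃ i, ⋃ s ∈ S i ∩ F n, Metric.closedBall s R₁ := by
      intro c hc
      obtain ⟨i, s, hs, hcs⟩ := hmeet c
      by_cases hsF : s ∈ F n
      · right
        simp only [Set.mem_iUnion]
        exact ⟨i, s, ⟨hs, hsF⟩, hcs⟩
      · exact Or.inl (mem_cthickening_frontier hc hsF hcs)
    refine (measure_mono hsub).trans ((measure_union_le _ _).trans (add_le_add_right ?_ _))
    rw [Finset.sum_mul]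
    refine (measure_iUnion_le _).trans ?_
    rw [tsum_fintype]
    exact Finset.sum_le_sum fun i _ => hball _
  have h1 := eventually_lt_of_limsup_lt hx
  have h2 := (hF.tendsto R₁ hR₁0).eventually_lt_const (u := 1 / 2) (by simp)
  obtain ⟨n, hn1, hn2⟩ := (h1.and h2).exists
  have h3 := ENNReal.div_le_div_right (hVn n) (volume (F n))
  rw [ENNReal.div_self (hF.volume_ne_zero n) (hF.volume_ne_top n), ENNReal.add_div,
    ENNReal.mul_div_right_comm] at h3
  have h4 : (∑ i, setCount (S i ∩ F n)) / volume (F n) * v ≤ 1 / 2 := by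
    refine (mul_le_mul_left hn1.le v).trans (le_of_eq ?_)
    rw [ENNReal.mul_inv (by simp) (by simp), mul_assoc, ENNReal.inv_mul_cancel hv0 hv1, mul_one,
      one_div]
  have h5 := ENNReal.add_lt_add_of_lt_of_le (ne_top_of_le_ne_top (by simp) h4) hn2 h4
  rw [ENNReal.add_halves] at h5
  exact absurd h3 (not_le.2 h5)

end Rho

/-! ### Comparison of Q^nΞ + 𝒦 with P_ε. -/

section Comparison

variable {d m : ℕ} {Λ : MultiColourSet d m} {Q : Euc d →ₗ[ℝ] Euc d}
  {D : Fin m → Fin m → Finset (Euc d)} {F : ℕ → Set (Euc d)}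

namespace IsStrongSubstitution

open Classical in
/-- The points `y` of `Λ` with `y + Q^k Ξ ⊈ Λ` have addresses in reduced digit sets, whose sizes
grow more slowly than the determinant of `Q ^ k`. -/
theorem exists_reduced_digits (h : IsStrongSubstitution Λ Q D) :
    ∃ (E : Fin m → Fin m → Finset (Euc d)) (C θ : ℝ), 0 ≤ θ ∧ θ < 1 ∧
      (∀ k i j, ((dig Q E k i j).card : ℝ) ≤ C * (θ * |LinearMap.det Q|) ^ k) ∧
      ∀ k i, ∀ y ∈ Λ i, ∀ z ∈ Xi Λ, y + (Q ^ k) z ∉ Λ i →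
        ∃ j, ∃ e ∈ dig Q E k i j, ∃ u ∈ Λ j, y = (Q ^ k) u + e := by
  obtain ⟨A, κ, hA⟩ := h.exists_tileSystem
  obtain ⟨i₀, hgood⟩ := h.good
  choose a ha hg using hgood
  set E : Fin m → Fin m → Finset (Euc d) := fun i j =>
    if i = i₀ then (D i j).erase (a j) else D i j with hE
  set ℓ : Fin m → ℝ := fun i => volume.real (A i) with hℓ
  have hℓ0 : ∀ i, 0 < ℓ i := fun i =>
    ENNReal.toReal_pos (hA.volume_pos h i).ne' (hA.volume_ne_top i)
  set δ := |LinearMap.det Q| with hδ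
  have hδ0 : 0 < δ := h.det_pos
  have hsumE : ∀ j, ∑ i, ℓ i * (E i j).card = δ * ℓ j - ℓ i₀ := by
    intro j
    have hi : ∀ i, ℓ i * (E i j).card = ℓ i * (D i j).card - if i = i₀ then ℓ i₀ else 0 := by
      intro i
      by_cases hi : i = i₀
      · subst hi
        simp only [hE, if_true]
        rw [Finset.card_erase_of_mem (ha j), Nat.cast_sub (Finset.card_pos.2 ⟨_, ha j⟩)]
        push_cast
        ring
      · simp [hE, hi]
    simp only [hi, Finset.sum_sub_distrib, Finset.sum_ite_eq', Finset.mem_univ, if_true]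
    rw [hℓ, hA.sum_volume h j]
  set s := ∑ i, ℓ i with hs
  have hℓs : ∀ i, ℓ i ≤ s := fun i =>
    Finset.single_le_sum (f := ℓ) (fun i _ => (hℓ0 i).le) (Finset.mem_univ i)
  have hs0 : 0 < s := (hℓ0 i₀).trans_le (hℓs i₀)
  -- The deleted digit costs column j the weight ℓ i₀; as ℓ j ≤ s, this is at least the fraction ℓ
  -- i₀ / (δ s) of δ ℓ j, uniformly in j.
  set θ := 1 - ℓ i₀ / (δ * s) with hθ
  have hstep : ∀ j, ∑ i, ℓ i * (E i j).card ≤ θ * δ * ℓ j := by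
    intro j
    rw [hsumE]
    have h1 : ℓ i₀ / (δ * s) * δ * ℓ j ≤ ℓ i₀ := by
      rw [div_mul_eq_mul_div, div_mul_eq_mul_div, div_le_iff₀ (mul_pos hδ0 hs0)]
      have := mul_le_mul_of_nonneg_left (hℓs j) (mul_nonneg (hℓ0 i₀).le hδ0.le)
      linarith
    rw [hθ]
    linarith
  have hθ0 : 0 ≤ θ := by
    have h1 : 0 ≤ θ * δ * ℓ i₀ :=
      (Finset.sum_nonneg fun i _ => mul_nonneg (hℓ0 i).le (Nat.cast_nonneg _)).trans (hstep i₀)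
    exact nonneg_of_mul_nonneg_left (nonneg_of_mul_nonneg_left h1 (hℓ0 i₀)) hδ0
  have hθ1 : θ < 1 := by
    have : 0 < ℓ i₀ / (δ * s) := div_pos (hℓ0 i₀) (mul_pos hδ0 hs0)
    linarith
  have hpow : ∀ k j, ∑ i, ℓ i * (dig Q E k i j).card ≤ (θ * δ) ^ k * ℓ j := by
    intro k j
    induction k with
    | zero => simp [dig, apply_ite Finset.card]
    | succ k ih =>
      calc ∑ i, ℓ i * ((dig Q E (k + 1) i j).card : ℝ)
          ≤ ∑ i, ℓ i * ∑ l, ((E i l).card : ℝ) * (dig Q E k l j).card :=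
            Finset.sum_le_sum fun i _ => mul_le_mul_of_nonneg_left
              (by exact_mod_cast card_dig_succ_le k i j) (hℓ0 i).le
        _ = ∑ l, (∑ i, ℓ i * (E i l).card) * (dig Q E k l j).card := by
            simp only [Finset.mul_sum, Finset.sum_mul, mul_assoc]
            exact Finset.sum_comm
        _ ≤ ∑ l, (θ * δ * ℓ l) * (dig Q E k l j).card :=
            Finset.sum_le_sum fun l _ => mul_le_mul_of_nonneg_right (hstep l) (Nat.cast_nonneg _)
        _ = θ * δ * ∑ l, ℓ l * (dig Q E k l j).card := by
            rw [Finset.mul_sum]; simp only [mul_assoc]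
        _ ≤ θ * δ * ((θ * δ) ^ k * ℓ j) :=
            mul_le_mul_of_nonneg_left ih (mul_nonneg hθ0 hδ0.le)
        _ = _ := by ring
  refine ⟨E, ∑ i, s / ℓ i, θ, hθ0, hθ1, fun k i j => ?_, ?_⟩
  · have h1 : ℓ i * (dig Q E k i j).card ≤ (θ * δ) ^ k * s :=
      (Finset.single_le_sum (f := fun i => ℓ i * ((dig Q E k i j).card : ℝ))
        (fun i _ => mul_nonneg (hℓ0 i).le (Nat.cast_nonneg _)) (Finset.mem_univ i)).trans
        ((hpow k j).trans (mul_le_mul_of_nonneg_left (hℓs j)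
          (pow_nonneg (mul_nonneg hθ0 hδ0.le) k)))
    have h2 : ((dig Q E k i j).card : ℝ) ≤ s / ℓ i * (θ * δ) ^ k := by
      rw [div_mul_eq_mul_div, le_div_iff₀ (hℓ0 i)]
      linarith
    refine h2.trans (mul_le_mul_of_nonneg_right ?_ (pow_nonneg (mul_nonneg hθ0 hδ0.le) k))
    exact Finset.single_le_sum (f := fun i => s / ℓ i)
      (fun i _ => (div_pos hs0 (hℓ0 i)).le) (Finset.mem_univ i)
  · intro k
    induction k with
    | zero =>
      intro i y hy z _ _
      exact ⟨i, 0, mem_dig_zero.2 ⟨rfl, rfl⟩, y, hy, by simp⟩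
    | succ k ih =>
      intro i y hy z hz hbad
      rw [← h.fixed, mem_mfs] at hy
      obtain ⟨l, u, hu, b, hb, rfl⟩ := hy
      rw [pow_succ', Module.End.mul_apply] at hbad
      -- The deleted digit would give y + Q(Q^k z) ∈ Λ, since Q^k z ∈ Ξ. With any other digit,
      -- failure at y passes to its parent u at level k.
      have hbE : b ∈ E i l := by
        simp only [hE]
        split_ifs with hi
        · subst hi
          refine Finset.mem_erase.2 ⟨fun hba => hbad ?_, hb⟩
          subst hba
          exact hg l u hu _ (pow_map_mem_Xi h.fixed h.exists_nonempty k hz)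
        · exact hb
      obtain ⟨j, e, he, v, hv, rfl⟩ := ih l u hu z hz fun hmem => hbad (by
        rw [← h.fixed, mem_mfs]
        exact ⟨l, _, hmem, b, hb, by rw [map_add]; abel⟩)
      refine ⟨j, b + Q e, mem_dig_succ.2 ⟨l, b, hbE, e, he, rfl⟩, v, hv, ?_⟩
      rw [pow_succ', Module.End.mul_apply, map_add]
      abel

/-- `ρ(Q^n z + Λ, Λ)` tends to `0` uniformly in `z ∈ Ξ`. -/
theorem exists_rho_pow_lt (h : IsStrongSubstitution Λ Q D) (hF : IsVanHove F) {ε : ℝ≥0∞}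
    (hε : 0 < ε) : ∃ n, ∀ z ∈ Xi Λ, rho F (translateMulti ((Q ^ n) z) Λ) Λ < ε := by
  obtain ⟨E, C, θ, hθ0, hθ1, hcard, hbad⟩ := h.exists_reduced_digits
  obtain ⟨r, hr, hsep⟩ := h.separated
  set δ := |LinearMap.det Q| with hδ
  have hδ0 : 0 < δ := h.det_pos
  set v := volume (Metric.ball (0 : Euc d) (r / 2)) with hv
  have hv0 : v ≠ 0 := (Metric.measure_ball_pos _ _ (by linarith)).ne'
  have hv1 : v ≠ ∞ := measure_ball_lt_top.ne
  have hbound : ∀ k, ∀ z ∈ Xi Λ, rho F (translateMulti ((Q ^ k) z) Λ) Λ ≤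
      (2 * ∑ i, ∑ j, ((dig Q E k i j).card : ℝ≥0∞)) / (ENNReal.ofReal (δ ^ k) * v) := by
    intro k z hz
    obtain ⟨L, hL1, hL⟩ := exists_norm_pow_le Q k
    set w := ENNReal.ofReal (δ ^ k) * v with hw
    have hw0 : w ≠ 0 := mul_ne_zero (by simpa using pow_pos hδ0 k) hv0
    have hw1 : w ≠ ∞ := ENNReal.mul_ne_top ENNReal.ofReal_ne_top hv1
    rw [rho_eq]
    refine limsup_div_le_of_mul_le hw0 hw1 (ENNReal.mul_ne_top (by simp)
      (ENNReal.sum_ne_top.2 fun i _ => ENNReal.sum_ne_top.2 fun j _ => by simp))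
      hF.volume_ne_zero hF.volume_ne_top (hF.tendsto (L * (r / 2)) (by positivity)) fun n => ?_
    set W := volume (F n) + volume (Metric.cthickening (L * (r / 2)) (frontier (F n))) with hW
    have hpiece : ∀ j b, setCount {y ∈ F n | ∃ u ∈ Λ j, y = (Q ^ k) u + b} * w ≤ W := by
      intro j b
      refine (setCount_mul_volume_le (h.pow_injective k) (hsep j) b
        (Z := F n ∪ Metric.cthickening (L * (r / 2)) (frontier (F n)))
        (fun u hu hmem p hp => mem_union_cthickening_frontier hmem ?_)).trans
        (measure_union_le _ _)
      rw [dist_add_right, dist_comm, dist_eq_norm, ← map_sub]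
      rw [dist_eq_norm] at hp
      exact (hL _).trans (mul_le_mul_of_nonneg_left hp.le (by linarith))
    have hcolour : ∀ i, setCount (symmDiff (translateMulti ((Q ^ k) z) Λ i) (Λ i) ∩ F n) * w ≤
        2 * (∑ j, ((dig Q E k i j).card : ℝ≥0∞)) * W := by
      intro i
      -- A point of the difference is a bad point of Λ for -z, or the translate by Q^k z of a bad
      -- point for z. Each reduced address therefore contributes two affine copies of Λ_j.
      have hsub : symmDiff (translateMulti ((Q ^ k) z) Λ i) (Λ i) ∩ F n ⊆
          ⋃ j, ⋃ e ∈ dig Q E k i j, {y ∈ F n | ∃ u ∈ Λ j, y = (Q ^ k) u + e} ∪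
            {y ∈ F n | ∃ u ∈ Λ j, y = (Q ^ k) u + (e + (Q ^ k) z)} := by
        rintro y ⟨hy, hyF⟩
        simp only [Set.mem_iUnion]
        rcases hy with ⟨hy1, hy2⟩ | ⟨hy1, hy2⟩
        · rw [mem_translateMulti] at hy1
          obtain ⟨j, e, he, u, hu, heq⟩ := hbad k i _ hy1 z hz (by simpa using hy2)
          exact ⟨j, e, he, Or.inr ⟨hyF, u, hu, by rw [← add_assoc, ← heq, sub_add_cancel]⟩⟩
        · rw [mem_translateMulti] at hy2
          obtain ⟨j, e, he, u, hu, heq⟩ := hbad k i _ hy1 (-z) (neg_mem_Xi hz)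
            (by rwa [map_neg, ← sub_eq_add_neg])
          exact ⟨j, e, he, Or.inl ⟨hyF, u, hu, heq⟩⟩
      calc _ ≤ (∑ j, ∑ e ∈ dig Q E k i j,
            setCount ({y ∈ F n | ∃ u ∈ Λ j, y = (Q ^ k) u + e} ∪
            {y ∈ F n | ∃ u ∈ Λ j, y = (Q ^ k) u + (e + (Q ^ k) z)})) * w :=
          mul_le_mul_left ((setCount_mono hsub).trans ((setCount_iUnion_le _).trans
            (Finset.sum_le_sum fun j _ => setCount_biUnion_le _ _))) _
        _ = ∑ j, ∑ e ∈ dig Q E k i j,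
            setCount ({y ∈ F n | ∃ u ∈ Λ j, y = (Q ^ k) u + e} ∪
            {y ∈ F n | ∃ u ∈ Λ j, y = (Q ^ k) u + (e + (Q ^ k) z)}) * w := by
          simp only [Finset.sum_mul]
        _ ≤ ∑ j, ∑ e ∈ dig Q E k i j, 2 * W :=
          Finset.sum_le_sum fun j _ => Finset.sum_le_sum fun e _ =>
            (mul_le_mul_left (setCount_union_le _ _) _).trans (by
              rw [add_mul, two_mul]
              exact add_le_add (hpiece j e) (hpiece j _))
        _ = _ := by
          simp only [Finset.sum_const, nsmul_eq_mul, ← Finset.sum_mul]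
          ring
    rw [Finset.sum_mul]
    refine (Finset.sum_le_sum fun i _ => hcolour i).trans (le_of_eq ?_)
    rw [← Finset.sum_mul, ← Finset.mul_sum]
  have hC0 : ∀ i : Fin m, 0 ≤ C := fun i => by
    have := hcard 0 i i
    simp only [pow_zero, mul_one] at this
    exact (Nat.cast_nonneg _).trans this
  have hnum : ∀ k, (2 * ∑ i, ∑ j, ((dig Q E k i j).card : ℝ≥0∞)) / (ENNReal.ofReal (δ ^ k) * v) ≤
      (2 * m * m * ENNReal.ofReal C / v) * ENNReal.ofReal (θ ^ k) := by
    intro k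
    have hw0 : ENNReal.ofReal (δ ^ k) ≠ 0 := by simpa using pow_pos hδ0 k
    have h1 : ∀ i j, ((dig Q E k i j).card : ℝ≥0∞) ≤
        ENNReal.ofReal C * ENNReal.ofReal (θ ^ k) * ENNReal.ofReal (δ ^ k) := by
      intro i j
      rw [← ENNReal.ofReal_natCast, ← ENNReal.ofReal_mul (hC0 i), ← ENNReal.ofReal_mul
        (mul_nonneg (hC0 i) (pow_nonneg hθ0 k)), mul_assoc, ← mul_pow]
      exact ENNReal.ofReal_le_ofReal (hcard k i j)
    have h2 : ∑ i, ∑ j, ((dig Q E k i j).card : ℝ≥0∞) ≤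
        m * (m * (ENNReal.ofReal C * ENNReal.ofReal (θ ^ k) * ENNReal.ofReal (δ ^ k))) := by
      refine (Finset.sum_le_sum fun i _ => Finset.sum_le_sum fun j _ => h1 i j).trans (le_of_eq ?_)
      simp
    refine (ENNReal.div_le_div_right (mul_le_mul_right h2 2) _).trans (le_of_eq ?_)
    rw [div_eq_mul_inv, div_eq_mul_inv,
      ENNReal.mul_inv (Or.inl hw0) (Or.inl ENNReal.ofReal_ne_top)]
    calc _ = 2 * m * m * ENNReal.ofReal C * v⁻¹ * ENNReal.ofReal (θ ^ k) *
        (ENNReal.ofReal (δ ^ k) * (ENNReal.ofReal (δ ^ k))⁻¹) := by ring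
      _ = _ := by rw [ENNReal.mul_inv_cancel hw0 ENNReal.ofReal_ne_top, mul_one]
  have hlim : Tendsto (fun k => (2 * m * m * ENNReal.ofReal C / v) * ENNReal.ofReal (θ ^ k))
      atTop (𝓝 0) := by
    have h1 := ENNReal.tendsto_ofReal (tendsto_pow_atTop_nhds_zero_of_lt_one hθ0 hθ1)
    have := ENNReal.Tendsto.const_mul (a := 2 * m * m * ENNReal.ofReal C / v) h1
      (Or.inr (ENNReal.div_ne_top (by finiteness) hv0))
    simpa using this
  obtain ⟨k, hk⟩ := (hlim.eventually_lt_const hε).exists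
  exact ⟨k, fun z hz => ((hbound k z hz).trans (hnum k)).trans_lt hk⟩

/-- Translations by periods do not change `ρ`. -/
theorem rho_add_period {x k : Euc d} (hk : k ∈ periods Λ) :
    rho F (translateMulti (x + k) Λ) Λ = rho F (translateMulti x Λ) Λ := by
  rw [translateMulti_add, show translateMulti k Λ = Λ from hk]

theorem rho_add_le (h : IsStrongSubstitution Λ Q D) (hF : IsVanHove F) (x y : Euc d) :
    rho F (translateMulti (x + y) Λ) Λ ≤
      rho F (translateMulti x Λ) Λ + rho F (translateMulti y Λ) Λ := by
  refine (rho_triangle _ (translateMulti x Λ) _).trans ?_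
  rw [add_comm]
  refine add_le_add_right ?_ _
  have := rho_translate_le hF h.separated x y 0
  rwa [translateMulti_zero, ← translateMulti_add] at this

theorem rho_neg_le (h : IsStrongSubstitution Λ Q D) (hF : IsVanHove F) (x : Euc d) :
    rho F (translateMulti (-x) Λ) Λ ≤ rho F (translateMulti x Λ) Λ := by
  have := rho_translate_le hF h.separated (-x) 0 x
  rwa [← translateMulti_add, ← translateMulti_add, neg_add_cancel, add_zero, translateMulti_zero,
    rho_comm Λ] at this

/-- Vanishing ρ forces agreement on a ball of the radius needed by `exists_repulsion` at level 0. -/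
theorem mem_periods_of_rho_eq_zero (h : IsStrongSubstitution Λ Q D) (hF : IsVanHove F)
    {x : Euc d} (hx : rho F (translateMulti x Λ) Λ = 0) : x ∈ periods Λ := by
  obtain ⟨r, hr⟩ := h.exists_repulsion ‖x‖
  obtain ⟨ε, hε, hag⟩ := exists_agreeOn_of_rho_lt (Λ := Λ) (Q := Q) hF r
  obtain ⟨c, hc⟩ := hag x (by rwa [hx])
  have := hr 0 c x le_rfl (by simpa using hc)
  simpa using this

theorem exists_mem_xiNhd_of_rho_lt (h : IsStrongSubstitution Λ Q D) (hF : IsVanHove F) (n : ℕ) :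
    ∃ ε : ℝ≥0∞, 0 < ε ∧ ∀ x, rho F (translateMulti x Λ) Λ < ε → x ∈ xiNhd Λ Q n := by
  obtain ⟨p, hp⟩ := h.exists_pow_map_mem_xiNhd
  obtain ⟨T, hT, hTp⟩ := h.exists_finite_periods p
  obtain ⟨ε₁, hε₁, hper⟩ : ∃ ε₁ : ℝ≥0∞, 0 < ε₁ ∧ ∀ l, (Q ^ p) l ∈ periods Λ →
      rho F (translateMulti l Λ) Λ < ε₁ → l ∈ periods Λ := by
    classical
    -- ρ is constant on classes modulo 𝒦, so ε₁ is its least nonzero value on the finitely many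
    -- representatives, or ∞ if there is none.
    refine ⟨hT.toFinset.inf fun t => if rho F (translateMulti t Λ) Λ = 0 then ∞ else
      rho F (translateMulti t Λ) Λ, ?_, fun l hl hrho => ?_⟩
    · rw [Finset.lt_inf_iff (by simp)]
      intro t _
      split_ifs with h0
      · simp
      · exact pos_iff_ne_zero.2 h0
    · obtain ⟨t, ht, hlt⟩ := hTp l hl
      have heq : rho F (translateMulti l Λ) Λ = rho F (translateMulti t Λ) Λ := by
        rw [← rho_add_period (x := t) hlt, add_sub_cancel]
      have h1 := hrho.trans_le (Finset.inf_le (hT.mem_toFinset.2 ht))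
      split_ifs at h1 with h0
      · exact h.mem_periods_of_rho_eq_zero hF (heq.trans h0)
      · rw [heq] at h1
        exact absurd h1 (lt_irrefl _)
  have hε₂ : 0 < ε₁ / 2 := ENNReal.half_pos hε₁.ne'
  obtain ⟨n', hn'⟩ := h.exists_rho_pow_lt hF hε₂
  set N := max n n' with hN
  obtain ⟨R, hR⟩ := hp (N + p)
  obtain ⟨ε₃, hε₃, hag⟩ := exists_agreeOn_of_rho_lt (Λ := Λ) (Q := Q) hF R
  refine ⟨min ε₃ (ε₁ / 2), lt_min hε₃ hε₂, fun x hx => ?_⟩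
  obtain ⟨c, hc⟩ := hag x (hx.trans_le (min_le_left _ _))
  obtain ⟨z, hz, k, hk, heq⟩ := hR x c hc
  -- Q^p l is a period, and x and Q^N z each contribute less than ε₁/2 to ρ(l + Λ, Λ), so l is a
  -- period.
  set l := x - (Q ^ N) z with hl
  have hlk : (Q ^ p) l = k := by
    rw [hl, map_sub, heq, add_comm N p, pow_add, Module.End.mul_apply, add_sub_cancel_left]
  have hzN : rho F (translateMulti ((Q ^ N) (-z)) Λ) Λ < ε₁ / 2 := by
    obtain ⟨t, ht⟩ := Nat.exists_eq_add_of_le (le_max_right n n')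
    rw [hN, ht, pow_add, Module.End.mul_apply]
    exact hn' _ (pow_map_mem_Xi h.fixed h.exists_nonempty t (neg_mem_Xi hz))
  have hlper : l ∈ periods Λ := by
    refine hper l (by rwa [hlk]) ?_
    rw [hl, sub_eq_add_neg, ← map_neg]
    refine (h.rho_add_le hF _ _).trans_lt ?_
    rw [← ENNReal.add_halves ε₁]
    exact ENNReal.add_lt_add (hx.trans_le (min_le_right _ _)) hzN
  exact h.xiNhd_antitone (le_max_left n n') ⟨z, hz, l, hlper, by rw [hl]; abel⟩

end IsStrongSubstitution

end Comparison

/-! ### Passage to a power of the substitution -/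

section Reduction

variable {d m : ℕ} {Λ : MultiColourSet d m} {Q : Euc d →ₗ[ℝ] Euc d}
  {D : Fin m → Fin m → Finset (Euc d)}

theorem IsExpansive.injective (hQ : IsExpansive Q) : Function.Injective Q := by
  obtain ⟨c, e, -, hc, h⟩ := hQ
  intro x y hxy
  have h1 := h x y
  rw [hxy, e.dist_self] at h1
  have h2 : 0 ≤ e.dist x y := @dist_nonneg _ e.toPseudoMetricSpace x y
  have h3 : e.dist x y = 0 := by nlinarith
  exact @eq_of_dist_eq_zero _ e x y h3

/-- The inverse powers of an expansive map tend to zero in norm. -/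
theorem IsExpansive.exists_two_mul_norm_le (hQ : IsExpansive Q) :
    ∃ q₀ : ℕ, ∀ q, q₀ ≤ q → ∀ v, 2 * ‖v‖ ≤ ‖(Q ^ q) v‖ := by
  have hinj := hQ.injective
  obtain ⟨c, e, he, hc, h⟩ := hQ
  set T := LinearEquiv.ofInjectiveEndo Q hinj with hT
  set B : Euc d →ₗ[ℝ] Euc d := T.symm.toLinearMap with hB
  have hQB : ∀ v, Q (B v) = v := fun v => T.apply_symm_apply v
  have hBQ : ∀ v, B (Q v) = v := fun v => T.symm_apply_apply v
  have hBpow : ∀ n v, (B ^ n) ((Q ^ n) v) = v := by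
    intro n
    induction n with
    | zero => simp
    | succ n ih =>
      intro v
      rw [pow_succ, pow_succ', Module.End.mul_apply, Module.End.mul_apply, hBQ, ih]
  have hcontr : ∀ n v, c ^ n * e.dist ((B ^ n) v) 0 ≤ e.dist v 0 := by
    intro n v
    induction n with
    | zero => simp
    | succ n ih =>
      have h1 := h ((B ^ (n + 1)) v) 0
      rw [map_zero, pow_succ', Module.End.mul_apply, hQB] at h1
      have h2 : 0 ≤ c ^ n := by positivity
      rw [pow_succ' B, Module.End.mul_apply, pow_succ]
      nlinarith
  -- The metric e shares only the topology with the norm, so contraction gives pointwise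
  -- convergence; a finite basis makes it uniform.
  have hlim : ∀ v, Tendsto (fun n => (B ^ n) v) atTop (𝓝 0) := by
    intro v
    have h1 : Tendsto (fun n => e.dist ((B ^ n) v) 0) atTop (𝓝 0) := by
      have h2 : Tendsto (fun n : ℕ => (c⁻¹) ^ n * e.dist v 0) atTop (𝓝 (0 * e.dist v 0)) :=
        (tendsto_pow_atTop_nhds_zero_of_lt_one (by positivity) (inv_lt_one_of_one_lt₀ hc)).mul_const _
      rw [zero_mul] at h2
      refine squeeze_zero (fun n => @dist_nonneg _ e.toPseudoMetricSpace _ _) (fun n => ?_) h2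
      rw [inv_pow, ← div_eq_inv_mul, le_div_iff₀ (by positivity), mul_comm]
      exact hcontr n v
    have h3 := (@tendsto_iff_dist_tendsto_zero _ _ e.toPseudoMetricSpace _ _ _).2 h1
    rwa [show e.toPseudoMetricSpace.toUniformSpace.toTopologicalSpace = _ from he] at h3
  set b := EuclideanSpace.basisFun (Fin d) ℝ with hb
  have hsum : Tendsto (fun n => ∑ i, ‖(B ^ n) (b i)‖) atTop (𝓝 0) := by
    have : Tendsto (fun n => ∑ i, ‖(B ^ n) (b i)‖) atTop (𝓝 (∑ _i : Fin d, 0)) :=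
      tendsto_finsetSum _ fun i _ => by simpa using (hlim (b i)).norm
    simpa using this
  obtain ⟨q₀, hq₀⟩ := eventually_atTop.1 (hsum.eventually_lt_const (u := 1 / 2) (by norm_num))
  refine ⟨q₀, fun q hq v => ?_⟩
  have hle : ∀ w, ‖(B ^ q) w‖ ≤ 1 / 2 * ‖w‖ := by
    intro w
    have h1 : (B ^ q) w = ∑ i, w i • (B ^ q) (b i) := by
      conv_lhs => rw [← b.sum_repr w]
      simp [hb]
    rw [h1]
    calc _ ≤ ∑ i, ‖w i • (B ^ q) (b i)‖ := norm_sum_le _ _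
      _ ≤ ∑ i, ‖w‖ * ‖(B ^ q) (b i)‖ := Finset.sum_le_sum fun i _ => by
        rw [norm_smul]
        exact mul_le_mul_of_nonneg_right (PiLp.norm_apply_le w i) (norm_nonneg _)
      _ = (∑ i, ‖(B ^ q) (b i)‖) * ‖w‖ := by rw [← Finset.mul_sum, mul_comm]
      _ ≤ _ := mul_le_mul_of_nonneg_right (hq₀ q hq).le (norm_nonneg _)
  have := hle ((Q ^ q) v)
  rw [hBpow] at this
  linarith

/-- Primitivity provides one level. No Λ_i is empty, so every row of D has a digit, and positivity
persists. -/
theorem exists_dig_nonempty (hΛ : mfs Q D Λ = Λ) (hne : ∀ i, (Λ i).Nonempty)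
    (hprim : (substMatrix D).IsPrimitive) :
    ∃ k₀, 0 < k₀ ∧ ∀ k, k₀ ≤ k → ∀ i j, (dig Q D k i j).Nonempty := by
  obtain ⟨k₀, hk₀, hpos⟩ := hprim.exists_pos_pow
  refine ⟨k₀, hk₀, fun k hk => ?_⟩
  induction k, hk using Nat.le_induction with
  | base => exact fun i j => dig_nonempty_of_pow_pos (hpos i j).ne'
  | succ k _ ih =>
    intro i j
    obtain ⟨y, hy⟩ := hne i
    rw [← hΛ, mem_mfs] at hy
    obtain ⟨l, u, hu, a, ha, rfl⟩ := hy
    obtain ⟨e, he⟩ := ih l j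
    exact ⟨_, mem_dig_succ.2 ⟨l, a, ha, e, he, rfl⟩⟩

theorem IsSubstitutionDelone.digit_unique (hsub : IsSubstitutionDelone Λ Q D) (i j j' : Fin m)
    (a a' u u' : Euc d) (ha : a ∈ D i j) (ha' : a' ∈ D i j') (hu : u ∈ Λ j) (hu' : u' ∈ Λ j')
    (h : Q u + a = Q u' + a') : j = j' ∧ a = a' := by
  by_contra hne
  have := hsub.disjoint i j j' a a' ha ha' fun heq => hne (by simpa using heq)
  exact Set.disjoint_left.1 this ⟨u, hu, rfl⟩ ⟨u', hu', h.symm⟩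

/-- A power of the substitution has the strong properties. -/
theorem exists_strongSubstitution (hsub : IsSubstitutionDelone Λ Q D)
    (hprim : (substMatrix D).IsPrimitive) (hlegal : EveryClusterLegal Λ Q D)
    (hcoin : AlgebraicCoincidence Λ Q) :
    (∀ j, ∃ i, (D i j).Nonempty) ∧
      ∃ q, 1 ≤ q ∧ IsStrongSubstitution Λ (Q ^ q) (dig Q D q) := by
  have hΛ := hsub.substitution
  choose S hS using hsub.delone.1
  have hdense : ∀ i p, ∃ u ∈ Λ i, ‖u - p‖ ≤ (S i).coveringRadius := by
    intro i p
    obtain ⟨u, hu, hup⟩ := (S i).exists_dist_le_coveringRadius p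
    rw [dist_comm, dist_eq_norm] at hup
    exact ⟨u, hS i ▸ hu, hup⟩
  have hne : ∀ i, (Λ i).Nonempty := fun i => by
    obtain ⟨u, hu, -⟩ := hdense i 0
    exact ⟨u, hu⟩
  obtain ⟨q₀, hq₀⟩ := hsub.expansive.exists_two_mul_norm_le
  obtain ⟨k₀, hk₀, hdig⟩ := exists_dig_nonempty hΛ hne hprim
  have hcol : ∀ j, ∃ i, (D i j).Nonempty := by
    intro j
    obtain ⟨a, ha⟩ := hdig k₀ le_rfl j j
    obtain ⟨k, rfl⟩ := Nat.exists_eq_add_of_le' hk₀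
    obtain ⟨l, e, he, b, hb, rfl⟩ := mem_dig_add.1 ha
    rw [dig_one] at hb
    exact ⟨l, b, hb⟩
  refine ⟨hcol, ?_⟩
  obtain ⟨M, i₀, ξ, hM, hξ, hcoinc⟩ := hcoin
  -- The 2M levels lead from an ancestor η of ξ, of colour l, to ξ; the t further levels reach
  -- colour l from every colour j.
  obtain ⟨t, ht0, htq⟩ : ∃ t, k₀ ≤ t ∧ q₀ ≤ M + M + t := ⟨max k₀ q₀, le_max_left _ _, by omega⟩
  set q := M + M + t with hq
  refine ⟨q, by omega, ?_, ?_, ?_, ?_, ?_, ?_, ?_, ?_⟩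
  · funext i
    ext y
    rw [mem_mfs, ← mem_iff_exists_dig hΛ q]
  · exact dig_unique hsub.digit_unique hsub.expansive.injective hΛ q
  · have hfin : ∃ r : ℝ, 0 < r ∧ ∀ i, r ≤ (S i).packingRadius := by
      have : Nonempty (Fin m) := ⟨i₀⟩
      obtain ⟨i, hi⟩ := Finite.exists_min fun i => ((S i).packingRadius : ℝ)
      exact ⟨_, (S i).packingRadius_pos, hi⟩
    obtain ⟨r, hr, hle⟩ := hfin
    refine ⟨r, hr, fun i u hu v hv huv => (hle i).trans ?_⟩
    rw [← hS i] at hu hv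
    exact ((S i).packingRadius_lt_dist_of_mem_ne hu hv huv).le
  · refine ⟨1 + ∑ i, ((S i).coveringRadius : ℝ), by positivity, fun i p => ?_⟩
    obtain ⟨u, hu, hup⟩ := hdense i p
    refine ⟨u, hu, hup.trans ?_⟩
    have := Finset.single_le_sum (f := fun i => ((S i).coveringRadius : ℝ))
      (fun i _ => NNReal.coe_nonneg _) (Finset.mem_univ i)
    linarith
  · exact hq₀ q htq
  · exact hdig q (by omega)
  · intro P hP
    obtain ⟨k, a, j, -, x, -, hx⟩ := hlegal P hP
    -- The level k is extended by s ≥ k₀ levels to a multiple of q, which makes the starting colour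
    -- j' arbitrary.
    have hexp : k + k₀ ≤ q * (k + k₀) := Nat.le_mul_of_pos_left _ (by omega)
    obtain ⟨s, hs⟩ := Nat.exists_eq_add_of_le (show k ≤ q * (k + k₀) by omega)
    refine ⟨k + k₀, fun j' => ?_⟩
    obtain ⟨b, hb⟩ := hdig s (by omega) j j'
    refine ⟨a - (Q ^ k) x + (Q ^ k) b, fun i p hp => ?_⟩
    obtain ⟨e, he, heq⟩ := mem_mfs_iterate_onePoint.1 (hx i p hp)
    rw [mem_dig_mul, hs, mem_dig_add]
    refine ⟨j, e, he, b, hb, ?_⟩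
    rw [← sub_eq_iff_eq_add'.2 heq]
    abel
  · have hXi : ∀ z w, z ∈ Xi Λ → w ∈ Xi Λ → (Q ^ M) (z + w) ∈ Xi Λ := by
      intro z w hz hw
      have := sub_mem_Xi (hcoinc z hz) (hcoinc _ (neg_mem_Xi hw))
      rwa [add_sub_add_left_eq_sub, ← map_sub, sub_neg_eq_add] at this
    obtain ⟨l, η, hη, a, ha, hξη⟩ := (mem_iff_exists_dig hΛ (M + M)).1 hξ
    refine ⟨i₀, fun j => ?_⟩
    obtain ⟨b, hb⟩ := hdig t ht0 l j
    refine ⟨a + (Q ^ (M + M)) b, mem_dig_add.2 ⟨l, a, ha, b, hb, rfl⟩, fun u hu z hz => ?_⟩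
    have hv : (Q ^ t) u + b ∈ Λ l := (mem_iff_exists_dig hΛ t).2 ⟨j, u, hu, b, hb, rfl⟩
    -- With v = Q^t u + b, the child is Q^{2M}v + a and ξ = Q^{2M}η + a. Adding Q^q z to the child
    -- gives ξ + Q^{2M}((v - η) + Q^t z).
    have h1 := hcoinc _ (hXi _ _ (sub_mem_Xi hv hη) (pow_map_mem_Xi hΛ hcol t hz))
    rw [← Module.End.mul_apply, ← pow_add] at h1
    convert h1 using 1
    rw [hξη, hq, pow_add Q (M + M) t]
    simp only [Module.End.mul_apply, map_add, map_sub]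
    abel

theorem xiNhd_pow (q n : ℕ) : xiNhd Λ (Q ^ q) n = xiNhd Λ Q (q * n) := by
  simp only [xiNhd, pow_mul]

end Reduction

/-! ### Group topologies -/

/-- A filtered family of sets with the properties of neighbourhoods of zero defines a group
topology. -/
theorem exists_hasNhdBase {G ι : Type*} [AddCommGroup G] (p : ι → Prop) (U : ι → Set G)
    (hne : ∃ i, p i) (hdir : ∀ i j, p i → p j → ∃ k, p k ∧ U k ⊆ U i ∩ U j)
    (hzero : ∀ i, p i → 0 ∈ U i)
    (hadd : ∀ i, p i → ∃ j, p j ∧ ∀ x ∈ U j, ∀ y ∈ U j, x + y ∈ U i)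
    (hneg : ∀ i, p i → ∀ x ∈ U i, -x ∈ U i) :
    ∃ τ : AddGroupTopology G, HasNhdBase τ p U := by
  let B : AddGroupFilterBasis G := addGroupFilterBasisOfComm {V | ∃ i, p i ∧ U i = V}
    (by
      obtain ⟨i, hi⟩ := hne
      exact ⟨_, i, hi, rfl⟩)
    (by
      rintro _ _ ⟨i, hi, rfl⟩ ⟨j, hj, rfl⟩
      obtain ⟨k, hk, hsub⟩ := hdir i j hi hj
      exact ⟨_, ⟨k, hk, rfl⟩, hsub⟩)
    (by
      rintro _ ⟨i, hi, rfl⟩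
      exact hzero i hi)
    (by
      rintro _ ⟨i, hi, rfl⟩
      obtain ⟨j, hj, h⟩ := hadd i hi
      exact ⟨_, ⟨j, hj, rfl⟩, Set.add_subset_iff.2 h⟩)
    (by
      rintro _ ⟨i, hi, rfl⟩
      exact ⟨_, ⟨i, hi, rfl⟩, hneg i hi⟩)
  refine ⟨@AddGroupTopology.mk G _ B.topology B.isTopologicalAddGroup, fun α => ?_⟩
  refine (B.nhds_hasBasis α).to_hasBasis ?_ ?_
  · rintro _ ⟨i, hi, rfl⟩
    exact ⟨i, hi, subset_rfl⟩
  · exact fun i hi => ⟨U i, ⟨i, hi, rfl⟩, subset_rfl⟩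

theorem addGroupTopology_eq_of_hasNhdBase {G ι ι' : Type*} [AddCommGroup G]
    {τ τ' : AddGroupTopology G} {p : ι → Prop} {p' : ι' → Prop} {U : ι → Set G} {U' : ι' → Set G}
    (h : HasNhdBase τ p U) (h' : HasNhdBase τ' p' U')
    (hU : ∀ i, p i → ∃ j, p' j ∧ U' j ⊆ U i) (hU' : ∀ j, p' j → ∃ i, p i ∧ U i ⊆ U' j) :
    τ = τ' := by
  refine AddGroupTopology.toTopologicalSpace_injective (TopologicalSpace.ext_nhds fun α => ?_)
  refine (h α).ext (h' α) (fun i hi => ?_) (fun j hj => ?_)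
  · obtain ⟨j, hj, hsub⟩ := hU i hi
    exact ⟨j, hj, Set.image_mono hsub⟩
  · obtain ⟨i, hi, hsub⟩ := hU' j hj
    exact ⟨i, hi, Set.image_mono hsub⟩

theorem mainTheorem11 (d m : ℕ) (Λ : MultiColourSet d m) (Q : Euc d →ₗ[ℝ] Euc d)
    (D : Fin m → Fin m → Finset (Euc d))
    (hsub : IsSubstitutionDelone Λ Q D)
    (hprim : (substMatrix D).IsPrimitive)
    (hlegal : EveryClusterLegal Λ Q D)
    (hcoin : AlgebraicCoincidence Λ Q)
    (F : ℕ → Set (Euc d)) (hF : IsVanHove F) :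
    (∃ τQ : AddGroupTopology (groupL Λ), IsQTopology Λ Q τQ) ∧
    (∃ τP : AddGroupTopology (groupL Λ), IsPTopology Λ F τP) ∧
    ∀ τQ τP : AddGroupTopology (groupL Λ), IsQTopology Λ Q τQ → IsPTopology Λ F τP →
      @UniformContinuous (groupL Λ) (groupL Λ) (groupUniformity τQ) (groupUniformity τP)
        (fun x => x) ∧
      @UniformContinuous (groupL Λ) (groupL Λ) (groupUniformity τP) (groupUniformity τQ)
        (fun x => x) ∧
      τQ = τP ∧
      ∃ e : HausdorffCompletion τQ ≃ₜ+ HausdorffCompletion τP,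
        UniformContinuous e ∧ UniformContinuous e.symm ∧
        ∀ x : groupL Λ, e (toHausdorffCompletion τQ x) = toHausdorffCompletion τP x := by
  obtain ⟨hcol, q, hq, h⟩ := exists_strongSubstitution hsub hprim hlegal hcoin
  have hanti : Antitone (xiNhd Λ Q) := xiNhd_anti hsub.substitution hcol
  have hmem : ∀ n (x : groupL Λ), x ∈ qNhd Λ Q n ↔ (x : Euc d) ∈ xiNhd Λ Q n :=
    fun n x => Iff.rfl
  have hmemP : ∀ ε (x : groupL Λ), x ∈ pNhd Λ F ε ↔
      rho F (translateMulti (x : Euc d) Λ) Λ < ENNReal.ofReal ε := fun n x => Iff.rfl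
  have hqn : ∀ n, n ≤ q * n := fun n => Nat.le_mul_of_pos_left n hq
  refine ⟨?_, ?_, ?_⟩
  · refine exists_hasNhdBase _ _ ⟨1, le_rfl⟩ ?_ ?_ ?_ ?_
    · exact fun i j hi _ => ⟨max i j, hi.trans (le_max_left i j), fun x hx =>
        ⟨hanti (le_max_left i j) hx, hanti (le_max_right i j) hx⟩⟩
    · intro n _
      obtain ⟨i, -⟩ := h.good
      obtain ⟨u, hu⟩ := h.set_nonempty i
      refine ⟨0, ?_, 0, (periodGroup Λ).zero_mem, by simp⟩
      simpa using sub_mem_Xi hu hu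
    · intro n hn
      refine ⟨q * (n + 1), le_trans (by omega) (hqn _), fun x hx y hy => ?_⟩
      rw [hmem] at hx hy ⊢
      rw [← xiNhd_pow] at hx hy
      have := h.add_mem_xiNhd hx hy
      rw [xiNhd_pow] at this
      exact hanti (hqn n) this
    · exact fun n _ x hx => neg_mem_xiNhd hx
  · refine exists_hasNhdBase _ _ ⟨1, one_pos⟩ ?_ ?_ ?_ ?_
    · exact fun i j hi hj => ⟨min i j, lt_min hi hj, fun x hx =>
        ⟨lt_of_lt_of_le hx (ENNReal.ofReal_le_ofReal (min_le_left i j)),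
          lt_of_lt_of_le hx (ENNReal.ofReal_le_ofReal (min_le_right i j))⟩⟩
    · intro ε hε
      rw [hmemP, AddSubgroup.coe_zero, translateMulti_zero, rho_self]
      exact ENNReal.ofReal_pos.2 hε
    · intro ε hε
      refine ⟨ε / 2, half_pos hε, fun x hx y hy => ?_⟩
      rw [hmemP] at hx hy ⊢
      refine (h.rho_add_le hF x y).trans_lt ((ENNReal.add_lt_add hx hy).trans_eq ?_)
      rw [← ENNReal.ofReal_add (half_pos hε).le (half_pos hε).le, add_halves]
    · exact fun ε _ x hx => (h.rho_neg_le hF x).trans_lt hx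
  · intro τQ τP hτQ hτP
    have heq : τQ = τP := by
      refine addGroupTopology_eq_of_hasNhdBase hτQ hτP (fun n _ => ?_) (fun ε hε => ?_)
      · obtain ⟨ε, hε, hsubs⟩ := h.exists_mem_xiNhd_of_rho_lt hF n
        obtain ⟨ε', hε', hlt⟩ := ENNReal.lt_iff_exists_real_btwn.1 hε
        refine ⟨ε', ENNReal.ofReal_pos.1 hlt.1, fun x hx => ?_⟩
        have h1 := hsubs x (lt_trans hx hlt.2)
        rw [xiNhd_pow] at h1
        exact hanti (hqn n) h1
      · obtain ⟨n, hn⟩ := h.exists_rho_pow_lt hF (ENNReal.ofReal_pos.2 hε)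
        -- n + 1 instead of n ensures that the index is at least 1, as the base requires.
        refine ⟨q * (n + 1), le_trans (by omega) (hqn _), fun x hx => ?_⟩
        rw [hmem, ← xiNhd_pow] at hx
        obtain ⟨z, hz, k, hk, hx⟩ := h.xiNhd_antitone (Nat.le_succ n) hx
        rw [hmemP, hx, IsStrongSubstitution.rho_add_period hk]
        exact hn z hz
    subst heq
    exact ⟨@uniformContinuous_id _ (groupUniformity τQ),
      @uniformContinuous_id _ (groupUniformity τQ), rfl, ContinuousAddEquiv.refl _,
      uniformContinuous_id, uniformContinuous_id, fun x => rfl⟩
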